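/- **Theorem 1.5.** Simplicial complexes are finite, contain the empty face, and $\dim F=|F|-1$; the $h$-vector $(h_0,\dots,h_d)$ of a $(d-1)$-dimensional complex $\Delta$ is given by $h_j(\Delta)=\sum_{i=0}^{j}(-1)^{j-i}\binom{d-i}{d-j}f_{i-1}(\Delta)$, where $f_{i-1}(\Delta)$ is the number of faces with $i$ vertices. A *PS sphere* is a join of boundaries of simplices on pairwise disjoint nonempty vertex sets (the boundary of a vertex being $\{\emptyset\}$, and the empty join being $\{\emptyset\}$). A *PS ball* is a join $\sigma * S$ of a nonempty simplex $\sigma$ and a PS sphere $S$ with disjoint vertex sets; its boundary is $\partial\sigma * S$. A complex $\Delta$, pure of dimension $n$, is *PS ear-decomposable* if it is a union of subcomplexes $\Sigma_0\cup\Sigma_1\cup\dots\cup\Sigma_t$ ($t\ge 0$) such that $\Sigma_0$ is an $n$-dimensional PS sphere and, for $1\le j\le t$, $\Sigma_j$ is an $n$-dimensional PS ball with $\Sigma_j\cap\bigcup_{i<j}\Sigma_i=\partial\Sigma_j$. A vector $(v_0,\dots,v_s)$ is a *pure $\mathcal O$-sequence* if there is a finite set of monomials, closed under divisibility, whose maximal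 elements under divisibility all have degree $s$, containing exactly $v_i$ monomials of degree $i$ for $0\le i\le s$ (and at least one monomial). 1. If $\Delta$ is a $2$-dimensional PS ear-decomposable simplicial complex, then $h(\Delta)=(h_0,h_1,h_2,h_3)$ is a pure $\mathcal O$-sequence. 2. Consequently, Stanley's conjecture on matroid $h$-vectors holds in rank $3$: let $M$ be a matroid of rank $3$ on a finite ground set, with exactly $c$ coloops, and let $(h_0,h_1,h_2,h_3)$ be the $h$-vector of its complex of independent sets. Then $h_j=0$ for $3-c<j\le 3$, and $(h_0,\dots,h_{3-c})$ is a pure $\mathcal O$-sequence. In particular, if $M$ has no coloops, then $(h_0,h_1,h_2,h_3)$ is a pure $\mathcal O$-sequence. -/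

import Mathlib

namespace PSEar

/-! ### Simplicial complexes -/

/-- A simplicial complex on vertices taken from `V`: a family of finite sets of vertices that is
closed under taking subsets. The empty set counts as a face (of dimension `-1`), which is why this
is not Mathlib's `PreAbstractSimplicialComplex`, whose faces are nonempty; the empty face is needed
for joins and for the convention that the boundary of a vertex is `{∅}`.
In this lattice `⊔`, `⨆` are unions and `⊓` is intersection of subcomplexes. -/
abbrev SimpComplex (V : Type*) := LowerSet (Finset V)

variable {V : Type*}

/-- `Δ` has dimension `n`: the maximum of `dim F = |F| - 1` over the faces `F` exists and is `n`. -/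
def HasDim (Δ : SimpComplex V) (n : ℤ) : Prop :=
  IsGreatest {k : ℤ | ∃ F ∈ Δ, k = (F.card : ℤ) - 1} n

/-- `Δ` is pure of dimension `n`: it has dimension `n`, and so has every facet. -/
def IsPureOfDim (Δ : SimpComplex V) (n : ℤ) : Prop :=
  HasDim Δ n ∧ ∀ F, Maximal (· ∈ Δ) F → (F.card : ℤ) - 1 = n

/-- The number `f_{i-1}(Δ)` of faces with exactly `i` vertices. -/
noncomputable def numFaces (Δ : SimpComplex V) (i : ℕ) : ℕ :=
  {F : Finset V | F ∈ Δ ∧ F.card = i}.ncard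

/-- The entry `h_j(Δ) = ∑_{i=0}^{j} (-1)^{j-i} (d-i choose d-j) f_{i-1}(Δ)`, `0 ≤ j ≤ d`, of the
`h`-vector of a `(d-1)`-dimensional complex. -/
noncomputable def hEntry (d : ℕ) (Δ : SimpComplex V) (j : ℕ) : ℤ :=
  ∑ i ∈ Finset.range (j + 1),
    (-1) ^ (j - i) * ((d - i).choose (d - j) : ℤ) * (numFaces Δ i : ℤ)

/-! ### PS spheres and PS balls -/

/-- The simplex with vertex set `A`: all subsets of `A`. -/
def simplex (A : Finset V) : SimpComplex V := LowerSet.Iic A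

/-- The boundary of the simplex with vertex set `A`: all proper subsets of `A`.
For a single vertex this is `{∅}`. -/
def simplexBoundary (A : Finset V) : SimpComplex V := LowerSet.Iio A

open Classical in
/-- The join of two complexes (only used for complexes with disjoint vertex sets): its faces are
the unions of a face of the first with a face of the second. -/
def join (K L : SimpComplex V) : SimpComplex V where
  carrier := {F | ∃ G ∈ K, ∃ H ∈ L, F = G ∪ H}
  lower' := by
    rintro F F' hF' ⟨G, hG, H, hH, rfl⟩
    refine ⟨F' ∩ G, K.lower Finset.inter_subset_right hG,
      F' ∩ H, L.lower Finset.inter_subset_right hH, ?_⟩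
    rw [← Finset.inter_union_distrib_left]
    exact (Finset.inter_eq_left.mpr hF').symm

/-- The iterated join of the simplex boundaries on the given vertex sets. The join of no complexes
is `{∅}`. -/
def joinOfBoundaries (l : List (Finset V)) : SimpComplex V :=
  (l.map simplexBoundary).foldr join (simplex ∅)

/-- A PS sphere: a join of boundaries of simplices on pairwise disjoint nonempty vertex sets. -/
def IsPSSphere (S : SimpComplex V) : Prop :=
  ∃ l : List (Finset V), (∀ A ∈ l, A.Nonempty) ∧ l.Pairwise Disjoint ∧ S = joinOfBoundaries l

/-- `B` is a PS ball with boundary `C`: `B` is the join `σ * S` of a (nonempty) simplex `σ` and a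
PS sphere `S` with disjoint vertex sets, and `C = ∂B = ∂σ * S`. -/
def IsPSBallWithBoundary (B C : SimpComplex V) : Prop :=
  ∃ (A : Finset V) (S : SimpComplex V), A.Nonempty ∧ IsPSSphere S ∧ (∀ F ∈ S, Disjoint A F) ∧
    B = join (simplex A) S ∧ C = join (simplexBoundary A) S

/-! ### PS ear-decompositions -/

/-- `Δ` is an `n`-dimensional PS ear-decomposable simplicial complex: it is pure of dimension `n`
and is a union of subcomplexes `E 0, …, E t`, where `E 0` is an `n`-dimensional PS sphere and, for
`1 ≤ j ≤ t`, `E j` is an `n`-dimensional PS ball that meets `E 0 ∪ ⋯ ∪ E (j-1)` exactly in its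
boundary. -/
def IsPSEarDecomposable (Δ : SimpComplex V) (n : ℤ) : Prop :=
  IsPureOfDim Δ n ∧ ∃ (t : ℕ) (E : ℕ → SimpComplex V),
    Δ = (⨆ i, ⨆ (_ : i ≤ t), E i) ∧
    (IsPSSphere (E 0) ∧ HasDim (E 0) n) ∧
    ∀ j, 1 ≤ j → j ≤ t → HasDim (E j) n ∧
      IsPSBallWithBoundary (E j) (E j ⊓ ⨆ i, ⨆ (_ : i < j), E i)

/-! ### Multicomplexes and pure O-sequences -/

/-- A multicomplex in the variables indexed by `ι`: a finite set of monomials, given by their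
exponent vectors, that is closed under divisibility. -/
def IsMulticomplex {ι : Type*} (M : Finset (ι →₀ ℕ)) : Prop :=
  IsLowerSet (M : Set (ι →₀ ℕ))

/-- All monomials of `M` that are maximal under divisibility have the same degree. -/
def IsPureSet {ι : Type*} (M : Finset (ι →₀ ℕ)) : Prop :=
  ∀ μ ν, Maximal (· ∈ M) μ → Maximal (· ∈ M) ν → μ.degree = ν.degree

/-- The vector `(v_0, …, v_s)` is a pure O-sequence: it is the `F`-vector of a pure multicomplex
whose maximal degree is `s`. -/
def IsPureOSequence {s : ℕ} (v : Fin (s + 1) → ℤ) : Prop :=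
  ∃ (m : ℕ) (M : Finset (Fin m →₀ ℕ)), IsMulticomplex M ∧ IsPureSet M ∧
    IsGreatest {k : ℕ | ∃ μ ∈ M, k = μ.degree} s ∧
    ∀ i : Fin (s + 1), v i = ((M.filter (fun μ => μ.degree = (i : ℕ))).card : ℤ)

/-! ### Matroids -/

/-- The matroid simplicial complex of `M`: its faces are the independent sets of `M`. -/
def indepComplex (M : Matroid V) : SimpComplex V where
  carrier := {F | M.Indep (F : Set V)}
  lower' := fun _ _ h hF => Matroid.Indep.subset hF (Finset.coe_subset.mpr h)

end PSEar

namespace PSEar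
open Finset

/-! ### Rows of Pascal's triangle -/

/-! Everything is reduced to inequalities in n = h_1, K = h_2 - h_1 and h = h_3. In terms of face
numbers, n = f_0 - 3, K = f_1 - 3 f_0 + 6 and h = f_2 - f_1 + f_0 - 1. Write K = C(a+1,2) + b with b
≤ a, and let M(K) = C(a+2,3) + C(b+1,2) be Macaulay's bound.

Numerical side (`isPureOSequence_three`): for n ≥ 1, the vector (1, n, n+K, h) is a pure O-sequence
as soon as K ≤ C(n,2), n - 2 ≤ h and K + 1 ≤ h ≤ n + K + M(K). Outside one boundary case, fix a
variable z, take all n quadrics divisible by z and K quadrics without z, and choose the cubics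
anywhere between a set that suffices for purity and a large set compatible with divisibility.

Upper bound on h: the graph of the complex is rigid in the sense of `Rigid`. For such a graph K ≥ 0,
and every set N of at least three vertices spans at most 3|N| - 6 + K edges (`Rigid.edge_bounds`).
Inserting a vertex of degree j + 3 raises K by j and creates one triangle for each edge in its
neighbourhood, hence at most 3j + 3 + min(K, C(j,2)) triangles; `exists_macaulay_growth` says that M
grows fast enough to absorb them (`Rigid.triangle_bound`). Faces with three vertices are 3-cliques,
so h ≤ n + K + M(K).

Lower bounds on h: the two remaining inequalities hold for the tetrahedron, the bipyramid and the
octahedron, the only PS 2-spheres, and survive the attachment of each kind of ear. `EarLike` bundles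
all the invariants.

Matroids: no ear decomposition is produced; `EarLike` is proved directly. Without coloops, some
restriction is one of the three spheres (`Matroidal.exists_sphere`). Each further nonloop is a cone
point over a rank-two matroid complex without coloops, whose face numbers are controlled by
`edge_bounds_of_cotransitive`. Coloops only form a cone: they are deleted, and the ranks below three
need only elementary vectors. -/

theorem two_mul_choose_two (x : ℕ) : 2 * (x + 1).choose 2 = x * (x + 1) := by
  rw [Nat.choose_two_right, Nat.add_sub_cancel, mul_comm (x + 1) x]
  exact Nat.mul_div_cancel' (Nat.even_mul_succ_self x).two_dvd

theorem choose_two_succ (x : ℕ) : (x + 2).choose 2 = (x + 1).choose 2 + (x + 1) := by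
  rw [Nat.choose_succ_succ' (x + 1) 1]; simp; omega

theorem choose_three_succ (x : ℕ) : (x + 3).choose 3 = (x + 2).choose 3 + (x + 2).choose 2 := by
  rw [Nat.choose_succ_succ' (x + 2) 2, add_comm]

/-- Growth of Macaulay's function `C(a+1,2) + b ↦ C(a+2,3) + C(b+1,2)`. -/
theorem exists_macaulay_growth {a b : ℕ} (hb : b ≤ a) (j : ℕ) :
    ∃ a' b', b' ≤ a' ∧ (a' + 1).choose 2 + b' = (a + 1).choose 2 + b + j ∧
      (a + 2).choose 3 + (b + 1).choose 2 + j + min ((a + 1).choose 2 + b) (j.choose 2) ≤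
        (a' + 2).choose 3 + (b' + 1).choose 2 := by
  -- Increasing C(a+1,2) + b by one raises the Macaulay function by b + 1. For j ≤ a + 1 the gain is
  -- compared with j + C(j,2) = C(j+1,2), for larger j with j + K.
  rcases Nat.lt_or_ge j (a + 2) with hj | hj
  · have hjj : (j + 1).choose 2 = j + j.choose 2 := by
      rw [Nat.choose_succ_succ' j 1]; simp
    have hmin := min_le_right ((a + 1).choose 2 + b) (j.choose 2)
    have h1 := two_mul_choose_two b
    have h2 := two_mul_choose_two j
    rcases Nat.lt_or_ge a (b + j) with h | h
    · obtain ⟨c, hc⟩ : ∃ c, b + j = a + 1 + c := ⟨b + j - (a + 1), by omega⟩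
      refine ⟨a + 1, c, by omega, by rw [choose_two_succ]; omega, ?_⟩
      have h3 := two_mul_choose_two c
      have h4 := two_mul_choose_two (a + 1)
      have h5 := choose_three_succ a
      -- Convexity: b + j = (a + 1) + c, and b and j both lie between c and a + 1.
      have : (b + 1).choose 2 + (j + 1).choose 2 ≤ (a + 1 + 1).choose 2 + (c + 1).choose 2 := by
        zify at *
        have : ((a : ℤ) + 1 - b) * (a + 1 - j) ≥ 0 := mul_nonneg (by linarith) (by linarith)
        have hc' : (c : ℤ) = b + j - (a + 1) := by linarith
        rw [hc'] at h3
        nlinarith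
      simp only [Nat.add_assoc, Nat.reduceAdd] at *
      omega
    · refine ⟨a, b + j, h, by omega, ?_⟩
      have h3 := two_mul_choose_two (b + j)
      have : (b + 1).choose 2 + (j + 1).choose 2 ≤ (b + j + 1).choose 2 := by nlinarith
      omega
  · suffices ∃ a' b', b' ≤ a' ∧ (a' + 1).choose 2 + b' = (a + 1).choose 2 + b + j ∧
        (a + 2).choose 3 + (b + 1).choose 2 + j + ((a + 1).choose 2 + b) ≤
          (a' + 2).choose 3 + (b' + 1).choose 2 by
      obtain ⟨a', b', h1, h2, h3⟩ := this
      exact ⟨a', b', h1, h2, le_trans (by gcongr; exact min_le_left _ _) h3⟩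
    -- At j = a + 2 the row index and the remainder both go up by one, and the gain is exactly j +
    -- K. Each later unit step gains at least 1.
    induction j, hj using Nat.le_induction with
    | base =>
      refine ⟨a + 1, b + 1, by omega, by rw [choose_two_succ]; omega, ?_⟩
      have := choose_three_succ a
      have := choose_two_succ a
      have := choose_two_succ b
      simp only [Nat.add_assoc, Nat.reduceAdd] at *
      omega
    | succ j hj ih =>
      obtain ⟨a', b', h1, h2, h3⟩ := ih
      rcases h1.lt_or_eq with h | rfl
      · refine ⟨a', b' + 1, h, by omega, ?_⟩
        have := choose_two_succ b'
        simp only [Nat.add_assoc, Nat.reduceAdd] at *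
        omega
      · refine ⟨b' + 1, 0, by omega, by rw [choose_two_succ]; omega, ?_⟩
        have := choose_three_succ b'
        have := choose_two_succ b'
        simp only [Nat.add_assoc, Nat.reduceAdd, Nat.zero_add, Nat.choose_succ_self] at *
        omega

/-! ### Counting cliques -/

section Clique

open Classical

variable {V : Type*} (G : SimpleGraph V)

/-- The number of `i`-element cliques of `G` inside `W`. -/
noncomputable def cliqueCount (i : ℕ) (W : Finset V) : ℕ :=
  #((W.powersetCard i).filter fun F : Finset V => G.IsClique (F : Set V))

theorem cliqueCount_le_choose (i : ℕ) (W : Finset V) : cliqueCount G i W ≤ (#W).choose i :=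
  (card_filter_le _ _).trans (card_powersetCard i W).le

theorem cliqueCount_one (W : Finset V) : cliqueCount G 1 W = #W := by
  rw [cliqueCount, filter_true_of_mem, card_powersetCard, Nat.choose_one_right]
  intro F hF
  obtain ⟨x, rfl⟩ := card_eq_one.1 (mem_powersetCard.1 hF).2
  simp

/-- Cliques through w are w together with a clique in its neighbourhood. For i = 2, the new
triangles are the edges of the neighbourhood. -/
theorem cliqueCount_insert (i : ℕ) {W : Finset V} {w : V} (hw : w ∉ W) :
    cliqueCount G (i + 1) (insert w W) =
      cliqueCount G (i + 1) W + cliqueCount G i {x ∈ W | G.Adj w x} := by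
  have hdisj : Disjoint (W.powersetCard (i + 1)) ((W.powersetCard i).image (insert w)) := by
    rw [disjoint_left]
    rintro F hF hF'
    obtain ⟨F', -, rfl⟩ := mem_image.1 hF'
    exact hw ((mem_powersetCard.1 hF).1 (mem_insert_self _ _))
  rw [cliqueCount, powersetCard_succ_insert hw, filter_union,
    card_union_of_disjoint (disjoint_filter_filter hdisj), filter_image, card_image_of_injOn]
  · rw [cliqueCount, cliqueCount]
    congr 2
    ext F
    simp only [mem_filter, mem_powersetCard, coe_insert, SimpleGraph.isClique_insert, subset_iff]
    constructor
    · rintro ⟨⟨h1, h2⟩, h3, h4⟩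
      exact ⟨⟨fun x hx => ⟨h1 hx, h4 x hx (by rintro rfl; exact hw (h1 hx))⟩, h2⟩, h3⟩
    · rintro ⟨⟨h1, h2⟩, h3⟩
      exact ⟨⟨fun x hx => (h1 hx).1, h2⟩, h3, fun x hx _ => (h1 hx).2⟩
  · intro F hF F' hF' h
    rw [mem_coe, mem_filter, mem_powersetCard] at hF hF'
    have h1 : w ∉ F := fun h => hw (hF.1.1 h)
    have h2 : w ∉ F' := fun h => hw (hF'.1.1 h)
    rw [← erase_insert h1, ← erase_insert h2]
    exact congrArg (fun s => erase s w) h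

theorem cliqueCount_two_insert {W : Finset V} {w : V} (hw : w ∉ W) :
    cliqueCount G 2 (insert w W) = cliqueCount G 2 W + #{x ∈ W | G.Adj w x} := by
  rw [cliqueCount_insert G 1 hw, cliqueCount_one]

theorem cliqueCount_pair {x y : V} (h : x ≠ y) :
    cliqueCount G 2 {x, y} = if G.Adj x y then 1 else 0 := by
  have h0 : cliqueCount G 2 {y} = 0 :=
    Nat.le_zero.1 ((cliqueCount_le_choose G 2 {y}).trans (by simp))
  rw [cliqueCount_two_insert G (by simpa using h), h0, filter_singleton]
  split_ifs <;> simp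

@[simp] theorem cliqueCount_succ_empty (i : ℕ) : cliqueCount G (i + 1) ∅ = 0 :=
  Nat.le_zero.1 (cliqueCount_le_choose G (i + 1) ∅)

theorem three_le_card_filter {G : SimpleGraph V} {W : Finset V} {w a b c : V} (ha : a ∈ W)
    (hb : b ∈ W) (hc : c ∈ W) (hab : a ≠ b) (hac : a ≠ c) (hbc : b ≠ c) (h1 : G.Adj w a)
    (h2 : G.Adj w b) (h3 : G.Adj w c) : 3 ≤ #{x ∈ W | G.Adj w x} :=
  two_lt_card_iff.2 ⟨a, b, c, by simp [*], by simp [*], by simp [*], hab, hac, hbc⟩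

/-! ### Rigid graphs: bounds on edges and triangles -/

/-- A sufficient combinatorial condition for the graph induced on a vertex set to be generically
rigid in three-dimensional space. -/
inductive Rigid : Finset V → Prop
  | triangle (a b c : V) : G.Adj a b → G.Adj a c → G.Adj b c → Rigid {a, b, c}
  | octahedron (a a' b b' c c' : V) : a ≠ a' → b ≠ b' → c ≠ c' →
      ¬ G.Adj a a' → ¬ G.Adj b b' → ¬ G.Adj c c' →
      G.Adj a b → G.Adj a b' → G.Adj a' b → G.Adj a' b' →
      G.Adj a c → G.Adj a c' → G.Adj a' c → G.Adj a' c' →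
      G.Adj b c → G.Adj b c' → G.Adj b' c → G.Adj b' c' → Rigid {a, a', b, b', c, c'}
  | insert (W : Finset V) (w : V) : Rigid W → w ∉ W → 3 ≤ #{x ∈ W | G.Adj w x} →
      Rigid (insert w W)

variable {G}

theorem insert_six_rotate (a a' b b' c c' : V) :
    ({a, a', b, b', c, c'} : Finset V) = {c', b', c, a, a', b} ∧
    ({a, a', b, b', c, c'} : Finset V) = {b, b', a, a', c, c'} ∧
    ({a, a', b, b', c, c'} : Finset V) = {c, c', a, a', b, b'} := by
  refine ⟨?_, ?_, ?_⟩ <;> ext x <;> simp only [mem_insert, mem_singleton] <;> tauto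

theorem Rigid.of_octahedron_of_adj {a a' b b' c c' : V} (hb : b ≠ b') (hc : c ≠ c')
    (haa : G.Adj a a') (h1 : G.Adj a b) (h2 : G.Adj a b') (h3 : G.Adj a' b) (h4 : G.Adj a' b')
    (h5 : G.Adj a c) (h6 : G.Adj a c') (h7 : G.Adj a' c) (h8 : G.Adj a' c') (h9 : G.Adj b c)
    (h10 : G.Adj b c') (h11 : G.Adj b' c) (h12 : G.Adj b' c') :
    Rigid G {a, a', b, b', c, c'} := by
  have e1 := Rigid.insert _ c (Rigid.triangle a a' b haa h1 h3)
    (by simp [h5.ne', h7.ne', h9.ne'])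
    (three_le_card_filter (a := a) (b := a') (c := b) (by simp) (by simp) (by simp) haa.ne h1.ne
      h3.ne h5.symm h7.symm h9.symm)
  have e2 := Rigid.insert _ b' e1 (by simp [h2.ne', h4.ne', h11.ne, hb.symm])
    (three_le_card_filter (a := a) (b := a') (c := c) (by simp) (by simp) (by simp) haa.ne h5.ne
      h7.ne h2.symm h4.symm h11)
  have e3 := Rigid.insert _ c' e2 (by simp [h6.ne', h8.ne', h12.ne', hc.symm, h10.ne'])
    (three_le_card_filter (a := a) (b := a') (c := b) (by simp) (by simp) (by simp) haa.ne h1.ne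
      h3.ne h6.symm h8.symm h10.symm)
  rwa [(insert_six_rotate a a' b b' c c').1]

/-- The constructor demands three antipodal non-edges so that the counts 6, 12, 8 are exact. If some
antipodal pair is an edge, the six vertices arise instead from a triangle by three insertions of
degree at least 3. -/
theorem Rigid.of_octahedron {a a' b b' c c' : V} (ha : a ≠ a') (hb : b ≠ b') (hc : c ≠ c')
    (h1 : G.Adj a b) (h2 : G.Adj a b') (h3 : G.Adj a' b) (h4 : G.Adj a' b')
    (h5 : G.Adj a c) (h6 : G.Adj a c') (h7 : G.Adj a' c) (h8 : G.Adj a' c') (h9 : G.Adj b c)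
    (h10 : G.Adj b c') (h11 : G.Adj b' c) (h12 : G.Adj b' c') :
    Rigid G {a, a', b, b', c, c'} := by
  by_cases haa : G.Adj a a'
  · exact .of_octahedron_of_adj hb hc haa h1 h2 h3 h4 h5 h6 h7 h8 h9 h10 h11 h12
  by_cases hbb : G.Adj b b'
  · have := Rigid.of_octahedron_of_adj ha hc hbb h1.symm h3.symm h2.symm h4.symm h9 h10 h11 h12
      h5 h6 h7 h8
    rwa [(insert_six_rotate a a' b b' c c').2.1]
  by_cases hcc : G.Adj c c'
  · have := Rigid.of_octahedron_of_adj ha hb hcc h5.symm h7.symm h6.symm h8.symm h9.symm h11.symm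
      h10.symm h12.symm h1 h2 h3 h4
    rwa [(insert_six_rotate a a' b b' c c').2.2]
  exact .octahedron a a' b b' c c' ha hb hc haa hbb hcc h1 h2 h3 h4 h5 h6 h7 h8 h9 h10 h11 h12

/-- Extra edges may join antipodal vertices of an octahedron, so that case has to go through
`Rigid.of_octahedron`. The lemma keeps rigidity when ears add edges. -/
theorem Rigid.mono {G' : SimpleGraph V} (hG : G ≤ G') {W : Finset V} (h : Rigid G W) :
    Rigid G' W := by
  induction h with
  | triangle a b c h1 h2 h3 => exact .triangle a b c (hG h1) (hG h2) (hG h3)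
  | octahedron a a' b b' c c' ha hb hc _ _ _ h1 h2 h3 h4 h5 h6 h7 h8 h9 h10 h11 h12 =>
    exact .of_octahedron ha hb hc (hG h1) (hG h2) (hG h3) (hG h4) (hG h5) (hG h6) (hG h7) (hG h8)
      (hG h9) (hG h10) (hG h11) (hG h12)
  | insert W w _ hw h ih =>
    refine .insert W w ih hw (h.trans (card_le_card fun x hx => ?_))
    simp only [mem_filter] at hx ⊢
    exact ⟨hx.1, hG hx.2⟩

theorem cliqueCount_two_eq_choose {H : Finset V} (h : (#H).choose 2 ≤ cliqueCount G 2 H) :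
    G.IsClique (H : Set V) := by
  have h1 : #((H.powersetCard 2).filter fun F : Finset V => G.IsClique (F : Set V)) =
      #(H.powersetCard 2) :=
    le_antisymm (card_filter_le _ _) (by rw [card_powersetCard]; exact h)
  rw [card_filter_eq_iff] at h1
  intro x hx y hy hxy
  have := h1 {x, y} (mem_powersetCard.2 ⟨by simp_all [insert_subset_iff], card_pair hxy⟩)
  exact this (by simp) (by simp) hxy

theorem cliqueCount_octahedron {a a' b b' c c' : V} (ha : a ≠ a') (hb : b ≠ b') (hc : c ≠ c')
    (haa : ¬ G.Adj a a') (hbb : ¬ G.Adj b b') (hcc : ¬ G.Adj c c')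
    (h1 : G.Adj a b) (h2 : G.Adj a b') (h3 : G.Adj a' b) (h4 : G.Adj a' b')
    (h5 : G.Adj a c) (h6 : G.Adj a c') (h7 : G.Adj a' c) (h8 : G.Adj a' c') (h9 : G.Adj b c)
    (h10 : G.Adj b c') (h11 : G.Adj b' c) (h12 : G.Adj b' c') :
    #({a, a', b, b', c, c'} : Finset V) = 6 ∧ cliqueCount G 2 {a, a', b, b', c, c'} = 12 ∧
      cliqueCount G 3 {a, a', b, b', c, c'} = 8 := by
  have n1 := h1.ne; have n2 := h2.ne; have n3 := h3.ne; have n4 := h4.ne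
  have n5 := h5.ne; have n6 := h6.ne; have n7 := h7.ne; have n8 := h8.ne
  have n9 := h9.ne; have n10 := h10.ne; have n11 := h11.ne; have n12 := h12.ne
  have m1 := n1.symm; have m2 := n2.symm; have m3 := n3.symm; have m4 := n4.symm
  have m5 := n5.symm; have m6 := n6.symm; have m7 := n7.symm; have m8 := n8.symm
  have m9 := n9.symm; have m10 := n10.symm; have m11 := n11.symm; have m12 := n12.symm
  have q : cliqueCount G 2 {b, b', c, c'} = 4 := by
    rw [← insert_empty_eq c', cliqueCount_two_insert G (w := b) (by simp [*]),
      cliqueCount_two_insert G (w := b') (by simp [*]),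
      cliqueCount_two_insert G (w := c) (by simp [*]), cliqueCount_two_insert G (by simp)]
    simp [filter_insert, filter_singleton, *]
  refine ⟨by simp [*], ?_, ?_⟩
  · rw [cliqueCount_two_insert G (w := a) (by simp [*]),
      cliqueCount_two_insert G (w := a') (by simp [*]), q]
    simp [filter_insert, filter_singleton, *]
  · rw [← insert_empty_eq c', cliqueCount_insert G 2 (w := a) (by simp [*]),
      cliqueCount_insert G 2 (w := a') (by simp [*]),
      cliqueCount_insert G 2 (w := b) (by simp [*]),
      cliqueCount_insert G 2 (w := b') (by simp [*]),
      cliqueCount_insert G 2 (w := c) (by simp [*]), cliqueCount_insert G 2 (by simp)]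
    simp [filter_insert, filter_singleton, cliqueCount_pair, *]

/-- The quantity e - 3v + 6 plays the role of the dimension of the space of stresses: nonnegative on
W, and no larger on a subset than on W. The second half is later applied to the neighbourhood of an
inserted vertex. -/
theorem Rigid.edge_bounds {W : Finset V} (h : Rigid G W) :
    3 * #W ≤ cliqueCount G 2 W + 6 ∧
      ∀ H ⊆ W, 3 ≤ #H → cliqueCount G 2 H + 3 * #W ≤ cliqueCount G 2 W + 3 * #H := by
  induction h with
  | triangle a b c h1 h2 h3 =>
    have n1 := h1.ne; have n2 := h2.ne; have n3 := h3.ne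
    have hc : #({a, b, c} : Finset V) = 3 := by simp [*]
    constructor
    · rw [hc, cliqueCount_two_insert G (w := a) (by simp [n1, n2]), cliqueCount_pair G n3]
      simp [filter_insert, filter_singleton, *]
    · intro H hH h
      rw [eq_of_subset_of_card_le hH (by omega)]
  | octahedron a a' b b' c c' ha hb hc haa hbb hcc h1 h2 h3 h4 h5 h6 h7 h8 h9 h10 h11 h12 =>
    obtain ⟨hW, hE, -⟩ := cliqueCount_octahedron ha hb hc haa hbb hcc h1 h2 h3 h4 h5 h6 h7 h8 h9
      h10 h11 h12
    refine ⟨by omega, fun H hH h => ?_⟩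
    rcases hH.eq_or_ssubset with rfl | hss
    · omega
    have hlt := card_lt_card hss
    have hle := cliqueCount_le_choose G 2 H
    rw [hW, hE]
    rcases (by omega : #H = 3 ∨ #H = 4 ∨ #H = 5) with h | h | h <;> rw [h] at hle ⊢
    · have : (3 : ℕ).choose 2 = 3 := by decide
      omega
    · have : (4 : ℕ).choose 2 = 6 := by decide
      omega
    · have h5 : (5 : ℕ).choose 2 = 10 := by decide
      by_contra hcon
      -- Ten edges on five vertices form a clique, which cannot contain an antipodal pair. The
      -- single omitted vertex would then lie in two different antipodal pairs, whose vertices are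
      -- adjacent.
      have hcl : G.IsClique (H : Set V) := cliqueCount_two_eq_choose (by rw [h]; omega)
      have key : ∀ x y, x ≠ y → ¬ G.Adj x y → x ∉ H ∨ y ∉ H := by
        intro x y hxy hadj
        by_contra! hh
        exact hadj (hcl hh.1 hh.2 hxy)
      have hsd : #(({a, a', b, b', c, c'} : Finset V) \ H) = 1 := by
        rw [card_sdiff_of_subset hH]; omega
      obtain ⟨z, hz⟩ := card_eq_one.1 hsd
      have hmem : ∀ x, x ∈ ({a, a', b, b', c, c'} : Finset V) → x ∉ H → x = z := by
        intro x hx hxH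
        have : x ∈ ({a, a', b, b', c, c'} : Finset V) \ H := mem_sdiff.2 ⟨hx, hxH⟩
        rw [hz] at this
        exact mem_singleton.1 this
      have ka : a = z ∨ a' = z := (key a a' ha haa).imp (hmem _ (by simp)) (hmem _ (by simp))
      have kb : b = z ∨ b' = z := (key b b' hb hbb).imp (hmem _ (by simp)) (hmem _ (by simp))
      rcases ka with rfl | rfl <;> rcases kb with rfl | rfl
      · exact h1.ne rfl
      · exact h2.ne rfl
      · exact h3.ne rfl
      · exact h4.ne rfl
  | insert W w _ hw hd ih =>
    obtain ⟨ih1, ih2⟩ := ih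
    rw [cliqueCount_two_insert G hw, card_insert_of_notMem hw]
    refine ⟨by omega, fun H hH h => ?_⟩
    by_cases hwH : w ∈ H
    · obtain ⟨H', hwH', rfl⟩ : ∃ H', w ∉ H' ∧ H = Insert.insert w H' :=
        ⟨H.erase w, notMem_erase _ _, (insert_erase hwH).symm⟩
      have hsub : H' ⊆ W := (insert_subset_insert_iff hwH').1 hH
      rw [cliqueCount_two_insert G hwH', card_insert_of_notMem hwH']
      rw [card_insert_of_notMem hwH'] at h
      have hdeg : #{x ∈ H' | G.Adj w x} ≤ #{x ∈ W | G.Adj w x} :=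
        card_le_card (filter_subset_filter _ hsub)
      -- Here the induction hypothesis on subsets is unavailable when H' has two vertices; H then
      -- has at most three edges, and the lower bound on the edges of W suffices.
      rcases Nat.lt_or_ge (#H') 3 with h3 | h3
      · have h2 : #H' = 2 := by omega
        have := cliqueCount_le_choose G 2 H'
        have : #{x ∈ H' | G.Adj w x} ≤ #H' := card_filter_le _ _
        rw [h2] at *
        simp at *
        omega
      · have := ih2 H' hsub h3
        omega
    · have hsub : H ⊆ W := by
        rw [subset_insert_iff_of_notMem hwH] at hH
        exact hH
      have := ih2 H hsub h
      omega

/-- The bound on the number of triangles of a rigid graph with a given number of edges. -/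
theorem Rigid.triangle_bound {W : Finset V} (h : Rigid G W) :
    ∃ a b, b ≤ a ∧ cliqueCount G 2 W + 6 = 3 * #W + ((a + 1).choose 2 + b) ∧
      cliqueCount G 3 W + 8 ≤ 3 * #W + 2 * ((a + 1).choose 2 + b) +
        ((a + 2).choose 3 + (b + 1).choose 2) := by
  induction h with
  | triangle a b c h1 h2 h3 =>
    have n1 := h1.ne; have n2 := h2.ne; have n3 := h3.ne
    have hc : #({a, b, c} : Finset V) = 3 := by simp [*]
    have hb := (Rigid.triangle a b c h1 h2 h3).edge_bounds.1
    have h2 := cliqueCount_le_choose G 2 {a, b, c}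
    have h3 := cliqueCount_le_choose G 3 {a, b, c}
    rw [hc] at *
    simp at h2 h3
    refine ⟨0, 0, le_rfl, ?_, ?_⟩
    · simp; omega
    · simp; omega
  | octahedron a a' b b' c c' ha hb hc haa hbb hcc h1 h2 h3 h4 h5 h6 h7 h8 h9 h10 h11 h12 =>
    obtain ⟨hW, hE, hT⟩ := cliqueCount_octahedron ha hb hc haa hbb hcc h1 h2 h3 h4 h5 h6 h7 h8 h9
      h10 h11 h12
    exact ⟨0, 0, le_rfl, by rw [hW, hE]; simp, by rw [hW, hT]; simp⟩
  | insert W w hW hw hd ih =>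
    obtain ⟨a, b, hba, hE, hT⟩ := ih
    set N := {x ∈ W | G.Adj w x} with hN
    obtain ⟨j, hj⟩ : ∃ j, #N = j + 3 := ⟨#N - 3, by omega⟩
    obtain ⟨a', b', hba', hK, hm⟩ := exists_macaulay_growth hba j
    -- The neighbourhood N has j + 3 vertices; `e1` and `e2` bound its edges by 3j + 3 + K and by 3j
    -- + 3 + C(j,2), the two arguments of the minimum in the growth lemma.
    have e1 := hW.edge_bounds.2 N (filter_subset _ _) hd
    have e2 := cliqueCount_le_choose G 2 N
    have e3 := cliqueCount_two_insert G hw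
    have e4 := cliqueCount_insert G 2 hw
    have e5 : (j + 3).choose 2 = 3 * j + 3 + j.choose 2 := by
      have := choose_two_succ (j + 1)
      have := choose_two_succ j
      have : (j + 1).choose 2 = j + j.choose 2 := by
        rw [Nat.choose_succ_succ' j 1]; simp
      simp only [Nat.add_assoc, Nat.reduceAdd] at *
      omega
    rw [← hN] at e3 e4
    rw [hj] at e1 e2 e3
    rw [e5] at e2
    refine ⟨a', b', hba', ?_, ?_⟩
    · rw [e3, card_insert_of_notMem hw, hK]
      omega
    · rw [e4, card_insert_of_notMem hw]
      simp only [Nat.reduceAdd] at *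
      omega

end Clique

/-! ### Pure O-sequences from sets of multisets -/

section PureO

/-- Multisets replace exponent vectors, so that divisibility can be checked by erasing one element
at a time and purity by exhibiting a multiple of degree s. -/
theorem isPureOSequence_of_multisets {n s : ℕ} (v : Fin (s + 1) → ℤ)
    (M : Finset (Multiset (Fin n))) (hne : M.Nonempty)
    (hlower : ∀ m ∈ M, ∀ i ∈ m, m.erase i ∈ M)
    (hpure : ∀ m ∈ M, ∃ t ∈ M, m ≤ t ∧ t.card = s)
    (hv : ∀ i, v i = (#{m ∈ M | m.card = (i : ℕ)} : ℤ)) : IsPureOSequence v := by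
  have hlow : ∀ u m : Multiset (Fin n), m + u ∈ M → m ∈ M := by
    intro u
    induction u using Multiset.induction with
    | empty => intro m h; simpa using h
    | cons i u ih =>
      intro m h
      refine ih m ?_
      have := hlower _ h i (by simp)
      rwa [Multiset.add_cons, Multiset.erase_cons_head] at this
  let e : (Fin n →₀ ℕ) ≃o Multiset (Fin n) := Finsupp.orderIsoMultiset
  have hcard : ∀ μ, (e μ).card = μ.degree := fun μ => Finsupp.card_toMultiset μ
  have hmem : ∀ μ, μ ∈ M.map e.symm.toEquiv.toEmbedding ↔ e μ ∈ M := by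
    intro μ
    simp only [mem_map, Equiv.coe_toEmbedding]
    constructor
    · rintro ⟨m, hm, rfl⟩
      simpa using hm
    · exact fun h => ⟨e μ, h, by simp⟩
  have hmax : ∀ μ, Maximal (· ∈ M.map e.symm.toEquiv.toEmbedding) μ → μ.degree = s := by
    rintro μ ⟨h1, h2⟩
    obtain ⟨t, ht, hle, hs⟩ := hpure _ ((hmem μ).1 h1)
    have h3 : e.symm t ∈ M.map e.symm.toEquiv.toEmbedding := (hmem _).2 (by simpa using ht)
    have h4 : μ ≤ e.symm t := (e.le_symm_apply).2 hle
    have h5 : μ = e.symm t := le_antisymm h4 (h2 h3 h4)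
    rw [h5, ← hcard]
    simpa using hs
  refine ⟨n, M.map e.symm.toEquiv.toEmbedding, ?_, ?_, ⟨?_, ?_⟩, ?_⟩
  · intro μ ν hνμ hμ
    rw [mem_coe, hmem] at hμ ⊢
    obtain ⟨u, hu⟩ := Multiset.le_iff_exists_add.1 (e.monotone hνμ)
    exact hlow u _ (hu ▸ hμ)
  · intro μ ν hμ hν
    rw [hmax μ hμ, hmax ν hν]
  · obtain ⟨m, hm⟩ := hne
    obtain ⟨t, ht, -, hs⟩ := hpure m hm
    refine ⟨e.symm t, (hmem _).2 (by simpa using ht), ?_⟩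
    rw [← hcard]
    simpa using hs.symm
  · rintro k ⟨μ, hμ, rfl⟩
    obtain ⟨t, ht, hle, hs⟩ := hpure _ ((hmem μ).1 hμ)
    rw [← hcard, ← hs]
    exact Multiset.card_le_card hle
  · intro i
    rw [hv i]
    congr 1
    refine card_bij (fun m _ => e.symm m) ?_ ?_ ?_
    · intro m hm
      rw [mem_filter] at hm
      rw [mem_filter, hmem, ← hcard]
      simpa using hm
    · intro m _ m' _ h
      exact e.symm.injective h
    · intro μ hμ
      rw [mem_filter, hmem, ← hcard] at hμ
      exact ⟨e μ, by rw [mem_filter]; exact hμ, by simp⟩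

variable {n : ℕ}

/-- The multisets of size `k` on a finite set. -/
def multisets (A : Finset (Fin n)) (k : ℕ) : Finset (Multiset (Fin n)) :=
  (univ : Finset (Sym A k)).image fun m => m.1.map (↑)

theorem mem_multisets {A : Finset (Fin n)} {k : ℕ} {m : Multiset (Fin n)} :
    m ∈ multisets A k ↔ m.card = k ∧ ∀ i ∈ m, i ∈ A := by
  simp only [multisets, mem_image, mem_univ, true_and]
  constructor
  · rintro ⟨m, rfl⟩
    refine ⟨by rw [Multiset.card_map]; exact m.2, fun i hi => ?_⟩
    obtain ⟨x, -, rfl⟩ := Multiset.mem_map.1 hi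
    exact x.2
  · rintro ⟨h1, h2⟩
    lift m to Multiset A using h2
    exact ⟨⟨m, by simpa using h1⟩, rfl⟩

theorem card_multisets (A : Finset (Fin n)) (k : ℕ) :
    #(multisets A k) = (#A + k - 1).choose k := by
  rw [multisets, card_image_of_injective, card_univ, Sym.card_sym_eq_multichoose,
    Fintype.card_coe, Nat.multichoose_eq]
  intro m m' h
  exact Subtype.ext (Multiset.map_injective Subtype.val_injective h)

theorem erase_mem_multisets {A : Finset (Fin n)} {k : ℕ} {m : Multiset (Fin n)}
    (hm : m ∈ multisets A (k + 1)) {i : Fin n} (hi : i ∈ m) : m.erase i ∈ multisets A k := by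
  rw [mem_multisets] at hm ⊢
  exact ⟨by rw [Multiset.card_erase_of_mem hi, hm.1]; rfl,
    fun j hj => hm.2 j (Multiset.mem_of_mem_erase hj)⟩

theorem filter_card_eq {M : Finset (Multiset (Fin n))} {k l : ℕ} (h : ∀ m ∈ M, m.card = k) :
    #{m ∈ M | m.card = l} = if k = l then #M else 0 := by
  split_ifs with hkl
  · rw [filter_true_of_mem fun m hm => (h m hm).trans hkl]
  · rw [filter_false_of_mem fun m hm => by rw [h m hm]; exact hkl, card_empty]

theorem isPureOSequence_of_quadrics (v : Fin (2 + 1) → ℤ) (Q : Finset (Multiset (Fin n)))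
    (hn : 0 < n) (hQ : ∀ q ∈ Q, q.card = 2) (hcov : ∀ i, ∃ q ∈ Q, i ∈ q)
    (h0 : v 0 = 1) (h1 : v 1 = n) (h2 : v 2 = #Q) : IsPureOSequence v := by
  have hM0 : ∀ m ∈ multisets (univ : Finset (Fin n)) 0, m.card = 0 :=
    fun m hm => (mem_multisets.1 hm).1
  have hM1 : ∀ m ∈ multisets (univ : Finset (Fin n)) 1, m.card = 1 :=
    fun m hm => (mem_multisets.1 hm).1
  have hd1 : Disjoint (multisets (univ : Finset (Fin n)) 0) (multisets univ 1 ∪ Q) := by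
    rw [disjoint_left]
    intro m hm hm'
    rw [mem_union] at hm'
    have := hM0 m hm
    rcases hm' with h | h
    · have := hM1 m h; omega
    · have := hQ m h; omega
  have hd2 : Disjoint (multisets (univ : Finset (Fin n)) 1) Q := by
    rw [disjoint_left]
    intro m hm h
    have := hM1 m hm
    have := hQ m h
    omega
  have hc (k : ℕ) : #{m ∈ multisets (univ : Finset (Fin n)) 0 ∪ (multisets univ 1 ∪ Q) |
      m.card = k} = (if 0 = k then 1 else 0) + ((if 1 = k then n else 0) +
        if 2 = k then #Q else 0) := by
    rw [filter_union, card_union_of_disjoint (disjoint_filter_filter hd1), filter_union,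
      card_union_of_disjoint (disjoint_filter_filter hd2), filter_card_eq hM0, filter_card_eq hM1,
      filter_card_eq hQ, card_multisets, card_multisets]
    simp
  have hlift : ∀ m : Multiset (Fin n), m.card ≤ 1 → ∃ t ∈ Q, m ≤ t := by
    intro m hm
    rcases Nat.le_one_iff_eq_zero_or_eq_one.1 hm with h | h
    · obtain ⟨q, hq, -⟩ := hcov ⟨0, hn⟩
      exact ⟨q, hq, by rw [Multiset.card_eq_zero.1 h]; exact Multiset.zero_le q⟩
    · obtain ⟨i, rfl⟩ := Multiset.card_eq_one.1 h
      obtain ⟨q, hq, hi⟩ := hcov i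
      exact ⟨q, hq, Multiset.singleton_le.2 hi⟩
  refine isPureOSequence_of_multisets v (multisets univ 0 ∪ (multisets univ 1 ∪ Q)) ?_ ?_ ?_ ?_
  · exact ⟨0, mem_union_left _ (mem_multisets.2 (by simp))⟩
  · intro m hm i hi
    have hi' := Multiset.card_erase_of_mem hi
    have hpos := Multiset.card_pos_iff_exists_mem.2 ⟨i, hi⟩
    simp only [mem_union, mem_multisets] at hm ⊢
    rcases hm with h | h | h
    · omega
    · exact Or.inl ⟨by rw [hi', h.1]; rfl, by simp⟩
    · exact Or.inr (Or.inl ⟨by rw [hi', hQ m h]; rfl, by simp⟩)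
  · intro m hm
    simp only [mem_union] at hm
    have : ∃ t ∈ Q, m ≤ t := by
      rcases hm with h | h | h
      · exact hlift m (by rw [hM0 m h]; omega)
      · exact hlift m (by rw [hM1 m h])
      · exact ⟨m, h, le_rfl⟩
    obtain ⟨t, ht, hle⟩ := this
    exact ⟨t, mem_union_right _ (mem_union_right _ ht), hle, hQ t ht⟩
  · intro i
    rw [hc]
    fin_cases i <;> simp [h0, h1, h2]

/-- The constant 1 and all variables are added automatically, so that only covering and closure
between degrees 1, 2 and 3 remain to be checked. -/
theorem isPureOSequence_of_cubics (v : Fin (3 + 1) → ℤ) (Q T : Finset (Multiset (Fin n)))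
    (hn : 0 < n) (hQ : ∀ q ∈ Q, q.card = 2) (hcov : ∀ i, ∃ q ∈ Q, i ∈ q)
    (hT : ∀ t ∈ T, t.card = 3) (hTQ : ∀ t ∈ T, ∀ i ∈ t, t.erase i ∈ Q)
    (hQT : ∀ q ∈ Q, ∃ t ∈ T, q ≤ t)
    (h0 : v 0 = 1) (h1 : v 1 = n) (h2 : v 2 = #Q) (h3 : v 3 = #T) : IsPureOSequence v := by
  have hM0 : ∀ m ∈ multisets (univ : Finset (Fin n)) 0, m.card = 0 :=
    fun m hm => (mem_multisets.1 hm).1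
  have hM1 : ∀ m ∈ multisets (univ : Finset (Fin n)) 1, m.card = 1 :=
    fun m hm => (mem_multisets.1 hm).1
  have hd1 : Disjoint (multisets (univ : Finset (Fin n)) 0) (multisets univ 1 ∪ (Q ∪ T)) := by
    rw [disjoint_left]
    intro m hm hm'
    simp only [mem_union] at hm'
    have := hM0 m hm
    rcases hm' with h | h | h
    · have := hM1 m h; omega
    · have := hQ m h; omega
    · have := hT m h; omega
  have hd2 : Disjoint (multisets (univ : Finset (Fin n)) 1) (Q ∪ T) := by
    rw [disjoint_left]
    intro m hm h
    have := hM1 m hm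
    rcases mem_union.1 h with h | h
    · have := hQ m h; omega
    · have := hT m h; omega
  have hd3 : Disjoint Q T := by
    rw [disjoint_left]
    intro m hm h
    have := hQ m hm
    have := hT m h
    omega
  have hc (k : ℕ) : #{m ∈ multisets (univ : Finset (Fin n)) 0 ∪ (multisets univ 1 ∪ (Q ∪ T)) |
      m.card = k} = (if 0 = k then 1 else 0) + ((if 1 = k then n else 0) +
        ((if 2 = k then #Q else 0) + if 3 = k then #T else 0)) := by
    rw [filter_union, card_union_of_disjoint (disjoint_filter_filter hd1), filter_union,
      card_union_of_disjoint (disjoint_filter_filter hd2), filter_union,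
      card_union_of_disjoint (disjoint_filter_filter hd3), filter_card_eq hM0, filter_card_eq hM1,
      filter_card_eq hQ, filter_card_eq hT, card_multisets, card_multisets]
    simp
  have hlift : ∀ m : Multiset (Fin n), m.card ≤ 1 → ∃ t ∈ T, m ≤ t := by
    intro m hm
    rcases Nat.le_one_iff_eq_zero_or_eq_one.1 hm with h | h
    · obtain ⟨q, hq, -⟩ := hcov ⟨0, hn⟩
      obtain ⟨t, ht, -⟩ := hQT q hq
      exact ⟨t, ht, by rw [Multiset.card_eq_zero.1 h]; exact Multiset.zero_le t⟩
    · obtain ⟨i, rfl⟩ := Multiset.card_eq_one.1 h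
      obtain ⟨q, hq, hi⟩ := hcov i
      obtain ⟨t, ht, hle⟩ := hQT q hq
      exact ⟨t, ht, (Multiset.singleton_le.2 hi).trans hle⟩
  refine isPureOSequence_of_multisets v
    (multisets univ 0 ∪ (multisets univ 1 ∪ (Q ∪ T))) ?_ ?_ ?_ ?_
  · exact ⟨0, mem_union_left _ (mem_multisets.2 (by simp))⟩
  · intro m hm i hi
    have hi' := Multiset.card_erase_of_mem hi
    have hpos := Multiset.card_pos_iff_exists_mem.2 ⟨i, hi⟩
    simp only [mem_union, mem_multisets] at hm ⊢
    rcases hm with h | h | h | h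
    · omega
    · exact Or.inl ⟨by rw [hi', h.1]; rfl, by simp⟩
    · exact Or.inr (Or.inl ⟨by rw [hi', hQ m h]; rfl, by simp⟩)
    · exact Or.inr (Or.inr (Or.inl (hTQ m h i hi)))
  · intro m hm
    simp only [mem_union] at hm
    have : ∃ t ∈ T, m ≤ t := by
      rcases hm with h | h | h | h
      · exact hlift m (by rw [hM0 m h]; omega)
      · exact hlift m (by rw [hM1 m h])
      · exact hQT m h
      · exact ⟨m, h, le_rfl⟩
    obtain ⟨t, ht, hle⟩ := this
    exact ⟨t, mem_union_right _ (mem_union_right _ (mem_union_right _ ht)), hle, hT t ht⟩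
  · intro i
    rw [hc]
    fin_cases i <;> simp [h0, h1, h2, h3]

/-- Pure multicomplexes of degree three in which the variable `z` divides enough monomials: all
quadrics divisible by `z` occur, together with a set `Q` of others. -/
theorem isPureOSequence_of_star (v : Fin (3 + 1) → ℤ) (z : Fin n)
    (Q T : Finset (Multiset (Fin n))) (J : Finset (Fin n)) (h : ℕ)
    (hQ : ∀ q ∈ Q, q.card = 2 ∧ z ∉ q) (hT : ∀ t ∈ T, t.card = 3 ∧ z ∉ t)
    (hTQ : ∀ t ∈ T, ∀ i ∈ t, t.erase i ∈ Q) (hJ : J.Nonempty)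
    (hcov : ∀ i ≠ z, i ∈ J ∨ ∃ q ∈ Q, i ∈ q)
    (hlow : #Q + #J ≤ h) (hup : h ≤ n + #Q + #T)
    (h0 : v 0 = 1) (h1 : v 1 = n) (h2 : v 2 = n + #Q) (h3 : v 3 = h) : IsPureOSequence v := by
  set R : Finset (Multiset (Fin n)) := univ.image fun i => z ::ₘ {i} with hR
  have memR : ∀ i, z ::ₘ {i} ∈ R := fun i => mem_image_of_mem _ (mem_univ i)
  have cardR : #R = n := by
    rw [hR, card_image_of_injective, card_univ, Fintype.card_fin]
    intro i j hij
    simpa using hij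
  have disjQR : Disjoint Q R := by
    rw [disjoint_left]
    intro q hq hq'
    obtain ⟨i, -, rfl⟩ := mem_image.1 hq'
    exact (hQ _ hq).2 (by simp)
  have cardQR : #(Q ∪ R) = n + #Q := by
    rw [card_union_of_disjoint disjQR, cardR, add_comm]
  have hQR : ∀ q ∈ Q ∪ R, q.card = 2 := by
    intro q hq
    rcases mem_union.1 hq with hq | hq
    · exact (hQ q hq).1
    · obtain ⟨i, -, rfl⟩ := mem_image.1 hq
      simp
  have disjT : Disjoint ((Q ∪ R).image (z ::ₘ ·)) T := by
    rw [disjoint_left]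
    intro t ht ht'
    obtain ⟨q, -, rfl⟩ := mem_image.1 ht
    exact (hT _ ht').2 (by simp)
  have cardmax : #((Q ∪ R).image (z ::ₘ ·) ∪ T) = n + #Q + #T := by
    rw [card_union_of_disjoint disjT, card_image_of_injective _ (fun _ _ => (Multiset.cons_inj_right z).1),
      cardQR]
  -- The left side already divides out to every quadric: z q covers q and z x for x in q, while z² j
  -- covers z j and z². The right side contains only cubics all of whose quadratic divisors are
  -- present. Hence any set in between works, and one has size h.
  have hsub : Q.image (z ::ₘ ·) ∪ J.image (fun j => z ::ₘ z ::ₘ {j}) ⊆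
      (Q ∪ R).image (z ::ₘ ·) ∪ T := by
    refine union_subset ?_ ?_
    · exact (image_subset_image subset_union_left).trans subset_union_left
    · intro t ht
      obtain ⟨j, -, rfl⟩ := mem_image.1 ht
      exact mem_union_left _ (mem_image_of_mem _ (mem_union_right _ (memR j)))
  have cardmin : #(Q.image (z ::ₘ ·) ∪ J.image (fun j => z ::ₘ z ::ₘ {j})) ≤ h :=
    (card_union_le _ _).trans ((add_le_add card_image_le card_image_le).trans hlow)
  obtain ⟨S, hS1, hS2, hS3⟩ := exists_subsuperset_card_eq hsub cardmin (hup.trans cardmax.ge)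
  have memQ : ∀ q ∈ Q, z ::ₘ q ∈ S := fun q hq => hS1 (mem_union_left _ (mem_image_of_mem _ hq))
  have memJ : ∀ j ∈ J, z ::ₘ z ::ₘ {j} ∈ S :=
    fun j hj => hS1 (mem_union_right _ (mem_image_of_mem _ hj))
  refine isPureOSequence_of_cubics v (Q ∪ R) S z.pos hQR
    (fun i => ⟨_, mem_union_right _ (memR i), by simp⟩) ?_ ?_ ?_ h0 h1
    (by rw [h2, cardQR]; push_cast; ring) (by rw [h3, hS3])
  · intro t ht
    rcases mem_union.1 (hS2 ht) with ht | ht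
    · obtain ⟨q, hq, rfl⟩ := mem_image.1 ht
      simp [hQR q hq]
    · exact (hT t ht).1
  · intro t ht i hi
    rcases mem_union.1 (hS2 ht) with ht | ht
    · obtain ⟨q, hq, rfl⟩ := mem_image.1 ht
      by_cases hiz : i = z
      · subst hiz
        simpa using hq
      · have hiq : i ∈ q := by simpa [hiz] using hi
        have : (q.erase i).card = 1 := by rw [Multiset.card_erase_of_mem hiq, hQR q hq]; rfl
        obtain ⟨j, hj⟩ := Multiset.card_eq_one.1 this
        rw [Multiset.erase_cons_tail _ (by simpa using Ne.symm hiz), hj]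
        exact mem_union_right _ (memR j)
    · exact mem_union_left _ (hTQ t ht i hi)
  · intro q hq
    rcases mem_union.1 hq with hq | hq
    · exact ⟨_, memQ q hq, Multiset.le_cons_self q z⟩
    · obtain ⟨i, -, rfl⟩ := mem_image.1 hq
      by_cases hi : i = z
      · obtain ⟨j, hj⟩ := hJ
        refine ⟨_, memJ j hj, ?_⟩
        subst hi
        exact Multiset.cons_le_cons _ (Multiset.cons_le_cons _ (Multiset.zero_le _))
      · rcases hcov i hi with hj | ⟨q, hq, hiq⟩
        · exact ⟨_, memJ i hj, Multiset.le_cons_self _ z⟩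
        · exact ⟨_, memQ q hq, Multiset.cons_le_cons _ (Multiset.singleton_le.2 hiq)⟩

/-! ### Realising prescribed vectors by explicit monomials -/

/-- The pairs `{i, min (i + 1) N}` of consecutive variables. -/
def consecutive {N : ℕ} (i : Fin (N + 1)) : Multiset (Fin (N + 1)) :=
  i ::ₘ {⟨min (i + 1) N, by omega⟩}

/-- The sum of the two indices is 2i + 1 for i < N and 2N for i = N, hence strictly increasing. -/
theorem consecutive_injective {N : ℕ} : Function.Injective (consecutive (N := N)) := by
  intro i j hij
  have := congrArg (fun m => (m.map Fin.val).sum) hij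
  simp only [consecutive, Multiset.map_cons, Multiset.map_singleton, Multiset.sum_cons,
    Multiset.sum_singleton] at this
  ext
  omega

theorem consecutive_mem_multisets {N : ℕ} {A : Finset (Fin (N + 1))} {i : Fin (N + 1)}
    (hi : i ∈ A) (hi' : (⟨min (i + 1) N, by omega⟩ : Fin (N + 1)) ∈ A) :
    consecutive i ∈ multisets A 2 := by
  simp [mem_multisets, consecutive, hi, hi']

theorem isPureOSequence_two (v : Fin (2 + 1) → ℤ) (h : ℕ) (hn : 1 ≤ n) (hh : 1 ≤ h)
    (hnh : n ≤ h + 1) (hup : h ≤ (n + 1).choose 2)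
    (h0 : v 0 = 1) (h1 : v 1 = n) (h2 : v 2 = h) : IsPureOSequence v := by
  obtain ⟨N, rfl⟩ : ∃ N, n = N + 1 := ⟨n - 1, by omega⟩
  -- The N pairs starting below N cover all N + 1 variables. Inserting 0 matters only when N = 0,
  -- where the square of the single variable is needed.
  set A : Finset (Fin (N + 1)) := insert 0 (univ.filter fun i => i.val < N) with hA
  have hAcard : #A ≤ h := by
    rcases Nat.eq_zero_or_pos N with rfl | hN
    · have : #A ≤ Fintype.card (Fin 1) := card_le_univ A
      simp at this; omega
    · have : A = univ.erase (Fin.last N) := by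
        ext i
        simp only [hA, mem_insert, mem_filter, mem_univ, true_and, mem_erase, and_true, Fin.ext_iff,
          Fin.val_zero, Fin.val_last, ne_eq]
        omega
      rw [this, card_erase_of_mem (mem_univ _), card_univ, Fintype.card_fin]
      omega
  have hsub : A.image consecutive ⊆ multisets univ 2 := by
    intro q hq
    obtain ⟨i, -, rfl⟩ := mem_image.1 hq
    exact consecutive_mem_multisets (mem_univ _) (mem_univ _)
  obtain ⟨Q, hQ1, hQ2, hQ3⟩ := exists_subsuperset_card_eq hsub (card_image_le.trans hAcard)
    (hup.trans (by simp [card_multisets]))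
  refine isPureOSequence_of_quadrics v Q hn (fun q hq => (mem_multisets.1 (hQ2 hq)).1) ?_ h0 h1
    (by rw [h2, hQ3])
  intro i
  by_cases hi : i.val < N
  · exact ⟨_, hQ1 (mem_image_of_mem _ (a := i) (by simp [hA, hi])), by simp [consecutive]⟩
  · refine ⟨consecutive ⟨N - 1, by omega⟩, hQ1 (mem_image_of_mem _ ?_), ?_⟩
    · simp only [hA, mem_insert, mem_filter, mem_univ, true_and, Fin.ext_iff, Fin.val_zero]
      omega
    · simp only [consecutive, Multiset.mem_cons, Multiset.mem_singleton, Fin.ext_iff]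
      omega

theorem isPureOSequence_one (v : Fin (1 + 1) → ℤ) (hn : 1 ≤ n) (h0 : v 0 = 1) (h1 : v 1 = n) :
    IsPureOSequence v := by
  have hM0 : ∀ m ∈ multisets (univ : Finset (Fin n)) 0, m.card = 0 :=
    fun m hm => (mem_multisets.1 hm).1
  have hM1 : ∀ m ∈ multisets (univ : Finset (Fin n)) 1, m.card = 1 :=
    fun m hm => (mem_multisets.1 hm).1
  have hd : Disjoint (multisets (univ : Finset (Fin n)) 0) (multisets univ 1) := by
    rw [disjoint_left]
    intro m hm hm'
    have := hM0 m hm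
    have := hM1 m hm'
    omega
  refine isPureOSequence_of_multisets v (multisets (univ : Finset (Fin n)) 0 ∪ multisets univ 1) ?_ ?_ ?_ ?_
  · exact ⟨0, mem_union_left _ (mem_multisets.2 (by simp))⟩
  · intro m hm i hi
    have hi' := Multiset.card_erase_of_mem hi
    have hpos := Multiset.card_pos_iff_exists_mem.2 ⟨i, hi⟩
    simp only [mem_union, mem_multisets] at hm ⊢
    rcases hm with h | h
    · omega
    · exact Or.inl ⟨by rw [hi', h.1]; rfl, by simp⟩
  · intro m hm
    rcases mem_union.1 hm with h | h
    · refine ⟨{⟨0, hn⟩}, mem_union_right _ (mem_multisets.2 (by simp)), ?_, by simp⟩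
      rw [Multiset.card_eq_zero.1 (hM0 m h)]
      exact Multiset.zero_le _
    · exact ⟨m, hm, le_rfl, hM1 m h⟩
  · intro i
    rw [filter_union, card_union_of_disjoint (disjoint_filter_filter hd), filter_card_eq hM0,
      filter_card_eq hM1, card_multisets, card_multisets]
    fin_cases i <;> simp [h0, h1]

theorem isPureOSequence_zero (v : Fin (0 + 1) → ℤ) (h0 : v 0 = 1) : IsPureOSequence v := by
  refine isPureOSequence_of_multisets (n := 0) v {0} (by simp) (by simp) (by simp) ?_
  intro i
  obtain rfl : i = 0 := Fin.ext (by omega)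
  rw [h0]
  rfl

/-- In this range, apart from one exceptional case, every cubic can be taken divisible by variable
0. The K quadrics in the other variables are chosen to cover as many of them as possible, and `J`
collects the uncovered ones, or is {0} if there are none. -/
theorem isPureOSequence_three_of_le (v : Fin (3 + 1) → ℤ) {K h : ℕ} (hn : 1 ≤ n)
    (hK : K ≤ n.choose 2) (h4 : K + 1 ≤ h) (h5 : n ≤ h + 2) (h6 : h ≤ n + K)
    (h0 : v 0 = 1) (h1 : v 1 = n) (h2 : v 2 = n + K) (h3 : v 3 = h) : IsPureOSequence v := by
  obtain ⟨N, rfl⟩ : ∃ N, n = N + 1 := ⟨n - 1, by omega⟩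
  have star (Q : Finset (Multiset (Fin (N + 1)))) (J : Finset (Fin (N + 1))) (hQK : #Q = K)
      (hQ : Q ⊆ multisets (univ.erase 0) 2) (hJ : J.Nonempty)
      (hcov : ∀ i ≠ 0, i ∈ J ∨ ∃ q ∈ Q, i ∈ q) (hlow : K + #J ≤ h) : IsPureOSequence v := by
    refine isPureOSequence_of_star v 0 Q ∅ J h ?_ (by simp) (by simp) hJ hcov (by omega)
      (by simp; omega) h0 h1 (by rw [h2, hQK]) h3
    intro q hq
    have := mem_multisets.1 (hQ hq)
    exact ⟨this.1, fun h => by simpa using this.2 _ h⟩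
  have hbig (i : Fin (N + 1)) : i ≠ 0 ↔ 1 ≤ i.val := by
    rw [ne_eq, Fin.ext_iff, Fin.val_zero]; omega
  -- If K > N there is room for all N consecutive pairs among the variables 1, …, N, the last being
  -- a square. Otherwise exactly the pairs starting at 1, …, K are used; for K ≥ 1 they cover 1, …,
  -- min(K+1, N).
  rcases Nat.lt_or_ge N K with hNK | hNK
  · have hsub : (univ.erase (0 : Fin (N + 1))).image consecutive ⊆ multisets (univ.erase 0) 2 := by
      intro q hq
      obtain ⟨i, hi, rfl⟩ := mem_image.1 hq
      refine consecutive_mem_multisets hi ?_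
      simp only [mem_erase, mem_univ, and_true, hbig] at hi ⊢
      omega
    obtain ⟨Q, hQ1, hQ2, hQ3⟩ := exists_subsuperset_card_eq hsub
      (card_image_le.trans (by simp; omega)) (hK.trans (by simp [card_multisets]))
    refine star Q {0} hQ3 hQ2 (by simp) (fun i hi => Or.inr ⟨consecutive i, ?_, ?_⟩)
      (by simpa using h4)
    · exact hQ1 (mem_image_of_mem _ (by simpa using hi))
    · simp [consecutive]
  · set B : Finset (Fin (N + 1)) := {i | 1 ≤ i.val ∧ i.val ≤ K} with hB
    have hBcard : #B = K := by
      rw [hB, ← card_map Fin.valEmbedding]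
      have : ({i : Fin (N + 1) | 1 ≤ i.val ∧ i.val ≤ K} : Finset _).map Fin.valEmbedding =
          Icc 1 K := by
        ext x
        simp only [mem_map, mem_filter, mem_univ, true_and, Fin.valEmbedding_apply, mem_Icc]
        constructor
        · rintro ⟨i, hi, rfl⟩; exact hi
        · intro hx; exact ⟨⟨x, by omega⟩, hx, rfl⟩
      rw [this]; simp
    have hQ1 : #(B.image consecutive) = K := by
      rw [card_image_of_injective _ consecutive_injective, hBcard]
    have hQ2 : B.image consecutive ⊆ multisets (univ.erase 0) 2 := by
      intro q hq
      obtain ⟨i, hi, rfl⟩ := mem_image.1 hq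
      simp only [hB, mem_filter, mem_univ, true_and] at hi
      refine consecutive_mem_multisets ?_ ?_
      · simp only [mem_erase, mem_univ, and_true, hbig]; omega
      · simp only [mem_erase, mem_univ, and_true, hbig]; omega
    have hin (i : Fin (N + 1)) (hi : 1 ≤ i.val) (hK' : 1 ≤ K) (hi' : i.val ≤ K + 1) :
        ∃ q ∈ B.image consecutive, i ∈ q := by
      rcases Nat.lt_or_ge K i.val with h | h
      · refine ⟨_, mem_image_of_mem _ (a := ⟨K, by omega⟩) (by simp [hB]; omega), ?_⟩
        simp only [consecutive, Multiset.mem_cons, Multiset.mem_singleton, Fin.ext_iff]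
        omega
      · exact ⟨_, mem_image_of_mem _ (a := i) (by simp [hB]; omega), by simp [consecutive]⟩
    rcases Nat.eq_zero_or_pos K with rfl | hKpos
    -- With K = 0 the star construction needs one cubic for each of the N other variables. The
    -- hypotheses still allow h = N - 1 = n - 2, which requires a different multicomplex.
    · rcases Nat.lt_or_ge h N with hN | hN
      · -- the monomials are `xyw` and the cubes of the other variables
        have hN2 : 2 ≤ N := by omega
        let x : Fin (N + 1) := ⟨0, by omega⟩
        let y : Fin (N + 1) := ⟨1, by omega⟩
        let w : Fin (N + 1) := ⟨2, by omega⟩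
        let C : Finset (Fin (N + 1)) := {i | 3 ≤ i.val}
        have hC : #C + 3 = N + 1 := by
          have hu : C ∪ {x, y, w} = univ := by
            ext i
            simp only [C, x, y, w, mem_union, mem_filter, mem_univ, true_and, mem_insert,
              mem_singleton, Fin.ext_iff, iff_true]
            omega
          have hd : Disjoint C {x, y, w} := by
            simp [C, x, y, w]
          have h3 : #({x, y, w} : Finset (Fin (N + 1))) = 3 := by
            simp [x, y, w]
          rw [← h3, ← card_union_of_disjoint hd, hu, card_univ, Fintype.card_fin]
        have hxy : x ≠ y := by simp [x, y]
        have hxw : x ≠ w := by simp [x, w]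
        have hyw : y ≠ w := by simp [y, w]
        have hCx : ∀ i ∈ C, i ≠ x ∧ i ≠ y ∧ i ≠ w := by
          intro i hi
          simp only [C, mem_filter, mem_univ, true_and] at hi
          simp only [x, y, w, ne_eq, Fin.ext_iff]
          omega
        have hcase (i : Fin (N + 1)) : i = x ∨ i = y ∨ i = w ∨ i ∈ C := by
          simp only [C, x, y, w, mem_filter, mem_univ, true_and, Fin.ext_iff]
          omega
        have inj2 : Function.Injective fun i : Fin (N + 1) => ({i, i} : Multiset (Fin (N + 1))) := by
          intro i j hij
          have : i ∈ ({j, j} : Multiset (Fin (N + 1))) := by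
            rw [← show ({i, i} : Multiset _) = {j, j} from hij]; simp
          simpa using this
        have inj3 : Function.Injective
            fun i : Fin (N + 1) => ({i, i, i} : Multiset (Fin (N + 1))) := by
          intro i j hij
          have : i ∈ ({j, j, j} : Multiset (Fin (N + 1))) := by
            rw [← show ({i, i, i} : Multiset _) = {j, j, j} from hij]; simp
          simpa using this
        have cardP : #({{x, y}, {x, w}, {y, w}} : Finset (Multiset (Fin (N + 1)))) = 3 := by
          have e1 : ({x, y} : Multiset (Fin (N + 1))) ≠ {x, w} := by
            intro h
            have : y ∈ ({x, w} : Multiset (Fin (N + 1))) := by rw [← h]; simp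
            simp [hxy.symm, hyw] at this
          have e2 : ({x, y} : Multiset (Fin (N + 1))) ≠ {y, w} := by
            intro h
            have : x ∈ ({y, w} : Multiset (Fin (N + 1))) := by rw [← h]; simp
            simp [hxy, hxw] at this
          have e3 : ({x, w} : Multiset (Fin (N + 1))) ≠ {y, w} := by
            intro h
            have : x ∈ ({y, w} : Multiset (Fin (N + 1))) := by rw [← h]; simp
            simp [hxy, hxw] at this
          exact card_eq_three.2 ⟨_, _, _, e1, e2, e3, rfl⟩
        refine isPureOSequence_of_cubics v
          ({{x, y}, {x, w}, {y, w}} ∪ C.image fun i => {i, i})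
          ({{x, y, w}} ∪ C.image fun i => {i, i, i}) (by omega) ?_ ?_ ?_ ?_ ?_ h0 h1 ?_ ?_
        · intro q hq
          simp only [mem_union, mem_insert, mem_singleton, mem_image] at hq
          rcases hq with (rfl | rfl | rfl) | ⟨i, -, rfl⟩ <;> simp
        · intro i
          rcases hcase i with rfl | rfl | rfl | hi
          · exact ⟨{x, y}, by simp, by simp⟩
          · exact ⟨{x, y}, by simp, by simp⟩
          · exact ⟨{x, w}, by simp, by simp⟩
          · exact ⟨{i, i}, mem_union_right _ (mem_image.2 ⟨i, hi, rfl⟩), by simp⟩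
        · intro q hq
          simp only [mem_union, mem_singleton, mem_image] at hq
          rcases hq with rfl | ⟨i, -, rfl⟩ <;> simp
        · intro t ht i hi
          simp only [mem_union, mem_singleton, mem_image] at ht
          rcases ht with rfl | ⟨j, hj, rfl⟩
          · simp only [Multiset.insert_eq_cons, Multiset.mem_cons, Multiset.mem_singleton] at hi
            rcases hi with rfl | rfl | rfl
            · simp
            · rw [show ({x, y, w} : Multiset (Fin (N + 1))) = y ::ₘ {x, w} from
                Multiset.cons_swap x y {w}, Multiset.erase_cons_head]
              simp
            · rw [show ({x, y, w} : Multiset (Fin (N + 1))) = w ::ₘ {x, y} from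
                (congrArg (x ::ₘ ·) (Multiset.cons_swap y w 0)).trans (Multiset.cons_swap x w {y}),
                Multiset.erase_cons_head]
              simp
          · have : i = j := by simpa using hi
            subst this
            refine mem_union_right _ (mem_image.2 ⟨i, hj, ?_⟩)
            simp
        · intro q hq
          simp only [mem_union, mem_insert, mem_singleton, mem_image] at hq
          rcases hq with (rfl | rfl | rfl) | ⟨i, hi, rfl⟩
          · refine ⟨{x, y, w}, by simp, ?_⟩
            exact Multiset.cons_le_cons _ (Multiset.singleton_le.2 (by simp))
          · refine ⟨{x, y, w}, by simp, ?_⟩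
            exact Multiset.cons_le_cons _ (Multiset.singleton_le.2 (by simp))
          · exact ⟨{x, y, w}, by simp, Multiset.le_cons_self _ _⟩
          · exact ⟨{i, i, i}, mem_union_right _ (mem_image.2 ⟨i, hi, rfl⟩),
              Multiset.le_cons_self _ _⟩
        · rw [h2, card_union_of_disjoint, cardP, card_image_of_injective _ inj2]
          · omega
          · rw [disjoint_left]
            intro q hq hq'
            obtain ⟨i, hi, rfl⟩ := mem_image.1 hq'
            simp only [mem_insert, mem_singleton] at hq
            have hi' := hCx i hi
            rcases hq with h | h | h
            · have : i ∈ ({x, y} : Multiset (Fin (N + 1))) := by rw [← h]; simp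
              simp [hi'] at this
            · have : i ∈ ({x, w} : Multiset (Fin (N + 1))) := by rw [← h]; simp
              simp [hi'] at this
            · have : i ∈ ({y, w} : Multiset (Fin (N + 1))) := by rw [← h]; simp
              simp [hi'] at this
        · rw [h3, card_union_of_disjoint, card_singleton, card_image_of_injective _ inj3]
          · omega
          · rw [disjoint_singleton_left]
            intro hq'
            obtain ⟨i, hi, h⟩ := mem_image.1 hq'
            have hi' := hCx i hi
            have : i ∈ ({x, y, w} : Multiset (Fin (N + 1))) := by rw [← h]; simp
            simp [hi'] at this
      · rcases Nat.eq_zero_or_pos N with rfl | hN0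
        · refine star ∅ {0} rfl (by simp) (by simp) (fun i hi => ?_) (by simpa using h4)
          exact absurd (Fin.ext (by omega)) hi
        · refine star ∅ (univ.erase 0) rfl (by simp) ?_ (fun i hi => Or.inl (by simpa using hi))
            (by simpa using hN)
          exact ⟨⟨N, by omega⟩, by simp only [mem_erase, mem_univ, and_true, hbig]; omega⟩
    · rcases Nat.lt_or_ge (K + 1) N with hKN | hKN
      -- The variables left uncovered by the pairs are K+2, …, N. Together with the K quadrics they
      -- force N - 1 = n - 2 cubics, which is at most h.
      · set J : Finset (Fin (N + 1)) := {i | K + 2 ≤ i.val} with hJ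
        have hJcard : #J ≤ N - K - 1 := by
          rw [hJ, ← card_map Fin.valEmbedding]
          have : ({i : Fin (N + 1) | K + 2 ≤ i.val} : Finset _).map Fin.valEmbedding ⊆
              Icc (K + 2) N := by
            intro x
            simp only [mem_map, mem_filter, mem_univ, true_and, Fin.valEmbedding_apply, mem_Icc]
            rintro ⟨i, hi, rfl⟩
            omega
          exact (card_le_card this).trans (by simp; omega)
        refine star _ J hQ1 hQ2 ⟨⟨N, by omega⟩, by simp [hJ]; omega⟩ (fun i hi => ?_) (by omega)
        rw [hbig] at hi
        rcases Nat.lt_or_ge (K + 1) i.val with h | h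
        · exact Or.inl (by simp [hJ]; omega)
        · exact Or.inr (hin i hi hKpos h)
      · refine star _ {0} hQ1 hQ2 (by simp) (fun i hi => Or.inr ?_) (by simpa using h4)
        rw [hbig] at hi
        exact hin i hi hKpos (by omega)

/-- The Macaulay-extremal choice: all quadrics on a variables and y times b of these variables, with
all cubics on the a variables and y times all quadrics on the b variables. This supplies M(K) cubics
without z, enough for the upper bound. -/
theorem isPureOSequence_three_of_ge (v : Fin (3 + 1) → ℤ) {a b K h : ℕ} (hn : 1 ≤ n) (hba : b ≤ a)
    (hK : K = (a + 1).choose 2 + b) (hKn : K ≤ n.choose 2) (h4 : n + K ≤ h)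
    (h5 : h ≤ n + K + ((a + 2).choose 3 + (b + 1).choose 2))
    (h0 : v 0 = 1) (h1 : v 1 = n) (h2 : v 2 = n + K) (h3 : v 3 = h) : IsPureOSequence v := by
  let z : Fin n := ⟨0, hn⟩
  -- The assumption K ≤ C(n,2) ensures that, besides z, there is room for the a variables, and also
  -- for y when b > 0.
  have han : a < n := by
    by_contra hcon
    have h1 : (n + 1).choose 2 ≤ (a + 1).choose 2 := Nat.choose_le_choose 2 (by omega)
    have h2 : (n + 1).choose 2 = n + n.choose 2 := by
      rw [Nat.choose_succ_succ' n 1]; simp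
    omega
  have habn : 0 < b → a + 1 < n := by
    intro hb
    by_contra hcon
    have h1 : n.choose 2 ≤ (a + 1).choose 2 := Nat.choose_le_choose 2 (by omega)
    omega
  obtain ⟨A, hA, hAc⟩ := exists_subset_card_eq (s := univ.erase z) (n := a) (by simp; omega)
  obtain ⟨B, hB, hBc⟩ := exists_subset_card_eq (s := A) (n := b) (by omega)
  obtain ⟨y, hyA, hyz⟩ : ∃ y, y ∉ A ∧ (0 < b → y ≠ z) := by
    rcases Nat.eq_zero_or_pos b with hb | hb
    · exact ⟨z, fun h => by simpa using hA h, by omega⟩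
    · have : #A < #(univ.erase z) := by simp; have := habn hb; omega
      obtain ⟨y, hy, hyA⟩ := exists_mem_notMem_of_card_lt_card this
      exact ⟨y, hyA, fun _ => ne_of_mem_erase hy⟩
  have hzA : z ∉ A := fun h => by simpa using hA h
  have hyz' : ∀ i ∈ B, y ≠ z := fun i hi => hyz (by rw [← hBc]; exact card_pos.2 ⟨i, hi⟩)
  have hinj : Function.Injective (y ::ₘ · : Multiset (Fin n) → _) :=
    fun _ _ => (Multiset.cons_inj_right y).1
  have hdisj (k : ℕ) (l : ℕ) : Disjoint (multisets A k) ((multisets B l).image (y ::ₘ ·)) := by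
    rw [disjoint_left]
    intro m hm hm'
    obtain ⟨q, -, rfl⟩ := mem_image.1 hm'
    exact hyA ((mem_multisets.1 hm).2 y (by simp))
  have hQc : #(multisets A 2 ∪ (multisets B 1).image (y ::ₘ ·)) = K := by
    rw [card_union_of_disjoint (hdisj 2 1), card_image_of_injective _ hinj, card_multisets,
      card_multisets, hAc, hBc, hK]
    simp
  have hTc : #(multisets A 3 ∪ (multisets B 2).image (y ::ₘ ·)) =
      (a + 2).choose 3 + (b + 1).choose 2 := by
    rw [card_union_of_disjoint (hdisj 3 2), card_image_of_injective _ hinj, card_multisets,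
      card_multisets, hAc, hBc]
    simp
  have hz (k l : ℕ) (m : Multiset (Fin n))
      (hm : m ∈ multisets A (k + 2) ∪ (multisets B (k + 1)).image (y ::ₘ ·)) :
      m.card = k + 2 ∧ z ∉ m := by
    rcases mem_union.1 hm with hm | hm
    · rw [mem_multisets] at hm
      exact ⟨hm.1, fun h => hzA (hm.2 z h)⟩
    · obtain ⟨q, hq, rfl⟩ := mem_image.1 hm
      rw [mem_multisets] at hq
      refine ⟨by simp [hq.1], fun h => ?_⟩
      obtain ⟨i, hi⟩ := Multiset.card_pos_iff_exists_mem.1 (by rw [hq.1]; omega : 0 < q.card)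
      rcases Multiset.mem_cons.1 h with h | h
      · exact hyz' i (hq.2 i hi) h.symm
      · exact hzA (hB (hq.2 z h))
  refine isPureOSequence_of_star v z (multisets A 2 ∪ (multisets B 1).image (y ::ₘ ·))
    (multisets A 3 ∪ (multisets B 2).image (y ::ₘ ·)) univ h (hz 0 0) (hz 1 0) ?_ ⟨z, mem_univ z⟩
    (fun i _ => Or.inl (mem_univ i)) (by rw [hQc]; simp; omega) (by rw [hQc, hTc]; omega) h0 h1
    (by rw [h2, hQc]) h3
  intro t ht i hi
  rcases mem_union.1 ht with ht | ht
  · exact mem_union_left _ (erase_mem_multisets ht hi)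
  · obtain ⟨q, hq, rfl⟩ := mem_image.1 ht
    by_cases hiy : i = y
    · subst hiy
      rw [Multiset.erase_cons_head]
      rw [mem_multisets] at hq
      exact mem_union_left _ (mem_multisets.2 ⟨hq.1, fun j hj => hB (hq.2 j hj)⟩)
    · have hiq : i ∈ q := by simpa [hiy] using hi
      rw [Multiset.erase_cons_tail _ (by simpa using Ne.symm hiy)]
      exact mem_union_right _ (mem_image_of_mem _ (erase_mem_multisets hq hiq))

/-- A sufficient numerical condition for `(1, n, n + K, h)` to be a pure O-sequence. -/
theorem isPureOSequence_three (v : Fin (3 + 1) → ℤ) {a b K h : ℕ} (hn : 1 ≤ n) (hba : b ≤ a)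
    (hK : K = (a + 1).choose 2 + b) (hKn : K ≤ n.choose 2) (h4 : K + 1 ≤ h) (h5 : n ≤ h + 2)
    (h6 : h ≤ n + K + ((a + 2).choose 3 + (b + 1).choose 2))
    (h0 : v 0 = 1) (h1 : v 1 = n) (h2 : v 2 = n + K) (h3 : v 3 = h) : IsPureOSequence v := by
  rcases le_total h (n + K) with h7 | h7
  · exact isPureOSequence_three_of_le v hn hKn h4 h5 h7 h0 h1 h2 h3
  · exact isPureOSequence_three_of_ge v hn hba hK hKn h7 h6 h0 h1 h2 h3

end PureO

/-! ### Face numbers of simplicial complexes -/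

section Complexes

open Classical

variable {V : Type*}

theorem numFaces_eq_card_filter {Δ : SimpComplex V} {W : Finset V} (hW : ∀ F ∈ Δ, F ⊆ W) (i : ℕ) :
    numFaces Δ i = #((W.powersetCard i).filter fun F => F ∈ Δ) := by
  rw [numFaces, ← Set.ncard_coe_finset]
  congr 1
  ext F
  simp only [Set.mem_ofPred_eq, coe_filter, mem_powersetCard]
  exact ⟨fun h => ⟨⟨hW F h.1, h.2⟩, h.1⟩, fun h => ⟨h.2, h.1.2⟩⟩

theorem numFaces_zero {Δ : SimpComplex V} (h : ∅ ∈ Δ) : numFaces Δ 0 = 1 := by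
  rw [numFaces, Set.ncard_eq_one]
  refine ⟨∅, Set.ext fun F => ?_⟩
  simp only [Set.mem_ofPred_eq, Finset.card_eq_zero, Set.mem_singleton_iff]
  exact ⟨fun h => h.2, fun hF => ⟨hF ▸ h, hF⟩⟩

theorem numFaces_one {Δ : SimpComplex V} {W : Finset V} (hW : ∀ x, {x} ∈ Δ ↔ x ∈ W) :
    numFaces Δ 1 = #W := by
  rw [numFaces, ← card_image_of_injective W (singleton_injective (α := V)), ← Set.ncard_coe_finset]
  congr 1
  ext F
  simp only [Set.mem_ofPred_eq, coe_image, Set.mem_image, mem_coe]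
  constructor
  · rintro ⟨h1, h2⟩
    obtain ⟨x, rfl⟩ := Finset.card_eq_one.1 h2
    exact ⟨x, (hW x).1 h1, rfl⟩
  · rintro ⟨x, hx, rfl⟩
    exact ⟨(hW x).2 hx, card_singleton x⟩

theorem subset_of_forall_singleton_mem {Δ : SimpComplex V} {W : Finset V}
    (hW : ∀ x, {x} ∈ Δ ↔ x ∈ W) {F : Finset V} (hF : F ∈ Δ) : F ⊆ W :=
  fun x hx => (hW x).1 (Δ.lower (singleton_subset_iff.2 hx) hF)

/-- The graph of a simplicial complex. -/
def graph (Δ : SimpComplex V) : SimpleGraph V where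
  Adj a b := a ≠ b ∧ {a, b} ∈ Δ
  symm := ⟨fun a b h => ⟨h.1.symm, by rw [pair_comm]; exact h.2⟩⟩
  loopless := ⟨fun _ h => h.1 rfl⟩

theorem graph_mono {Δ Δ' : SimpComplex V} (h : Δ ≤ Δ') : graph Δ ≤ graph Δ' :=
  fun _ _ hab => ⟨hab.1, h hab.2⟩

theorem isClique_graph_of_mem {Δ : SimpComplex V} {F : Finset V} (hF : F ∈ Δ) :
    (graph Δ).IsClique (F : Set V) :=
  fun _ hx _ hy hxy => ⟨hxy, Δ.lower (insert_subset hx (singleton_subset_iff.2 hy)) hF⟩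

theorem numFaces_two {Δ : SimpComplex V} {W : Finset V} (hW : ∀ x, {x} ∈ Δ ↔ x ∈ W) :
    numFaces Δ 2 = cliqueCount (graph Δ) 2 W := by
  rw [numFaces_eq_card_filter (fun F => subset_of_forall_singleton_mem hW), cliqueCount]
  congr 1
  refine filter_congr fun F hF => ⟨isClique_graph_of_mem, fun h => ?_⟩
  obtain ⟨x, y, hxy, rfl⟩ := Finset.card_eq_two.1 (mem_powersetCard.1 hF).2
  exact (h (by simp) (by simp) hxy).2

theorem numFaces_le_cliqueCount {Δ : SimpComplex V} {W : Finset V} (hW : ∀ x, {x} ∈ Δ ↔ x ∈ W)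
    (i : ℕ) : numFaces Δ i ≤ cliqueCount (graph Δ) i W := by
  rw [numFaces_eq_card_filter (fun F => subset_of_forall_singleton_mem hW), cliqueCount]
  exact card_le_card (monotone_filter_right _ fun F _ => isClique_graph_of_mem)

/-! ### Invariants forcing the h-vector to be a pure O-sequence -/

/-- Numerical and combinatorial properties of a two-dimensional complex with vertex set `W` that
are preserved by attaching ears and that force the `h`-vector to be a pure O-sequence. -/
structure EarLike (Δ : SimpComplex V) (W : Finset V) : Prop where
  empty_mem : ∅ ∈ Δ
  singleton_mem : ∀ x, {x} ∈ Δ ↔ x ∈ W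
  rigid : Rigid (graph Δ) W
  four_le : 4 ≤ #W
  -- This is h_3 ≥ h_2 - h_1 + 1.
  edges_le : 2 * numFaces Δ 2 + 8 ≤ numFaces Δ 3 + 4 * #W
  -- This is h_3 ≥ h_1 - 2.
  edges_le' : numFaces Δ 2 ≤ numFaces Δ 3 + 4

theorem hEntry_three (Δ : SimpComplex V) (h0 : numFaces Δ 0 = 1) :
    hEntry 3 Δ 0 = 1 ∧ hEntry 3 Δ 1 = numFaces Δ 1 - 3 ∧
      hEntry 3 Δ 2 = numFaces Δ 2 - 2 * numFaces Δ 1 + 3 ∧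
      hEntry 3 Δ 3 = numFaces Δ 3 - numFaces Δ 2 + numFaces Δ 1 - 1 := by
  simp only [hEntry, sum_range_succ, sum_range_zero, h0]
  refine ⟨by norm_num, ?_, ?_, ?_⟩ <;> norm_num [Nat.choose] <;> ring

theorem EarLike.isPureOSequence {Δ : SimpComplex V} {W : Finset V} (h : EarLike Δ W) :
    IsPureOSequence (fun j : Fin (3 + 1) => hEntry 3 Δ j) := by
  obtain ⟨a, b, hba, hE, hT⟩ := h.rigid.triangle_bound
  obtain ⟨e0, e1, e2, e3⟩ := hEntry_three Δ (numFaces_zero h.empty_mem)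
  have f1 := numFaces_one h.singleton_mem
  have f2 := numFaces_two h.singleton_mem
  have f3 := numFaces_le_cliqueCount h.singleton_mem 3
  have hchoose := cliqueCount_le_choose (graph Δ) 2 W
  have h4 := h.four_le
  have h5 := h.edges_le
  have h6 := h.edges_le'
  obtain ⟨n, hn⟩ : ∃ n, #W = n + 3 := ⟨#W - 3, by omega⟩
  obtain ⟨K, hK⟩ : ∃ K, K = (a + 1).choose 2 + b := ⟨_, rfl⟩
  obtain ⟨t, ht⟩ : ∃ t, t = numFaces Δ 3 + #W - numFaces Δ 2 - 1 := ⟨_, rfl⟩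
  have hc3 : (n + 3).choose 2 = n.choose 2 + 3 * n + 3 := by
    have := choose_two_succ (n + 1)
    have := choose_two_succ n
    have : (n + 1).choose 2 = n + n.choose 2 := by
      rw [Nat.choose_succ_succ' n 1]; simp
    simp only [Nat.add_assoc, Nat.reduceAdd] at *
    omega
  rw [hn, hc3] at hchoose
  rw [← hK] at hE hT
  refine isPureOSequence_three (n := n) (a := a) (b := b) (K := K) (h := t) _ (by omega) hba hK
    (by omega) (by omega) (by omega) (by omega) e0 ?_ ?_ ?_
  · refine e1.trans ?_
    omega
  · refine e2.trans ?_
    omega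
  · refine e3.trans ?_
    omega

/-- Since the new faces are exactly A ∪ H with H in S and A disjoint from H, removing A gives a
bijection that lowers cardinality by |A|. -/
theorem numFaces_attach {Δ Δ' S : SimpComplex V} {A W : Finset V} (hle : Δ ≤ Δ')
    (hW : ∀ F ∈ Δ', F ⊆ W) (hnew : ∀ F, F ∈ Δ' ∧ F ∉ Δ ↔ ∃ H ∈ S, F = A ∪ H)
    (hdisj : ∀ H ∈ S, Disjoint A H) :
    (∀ i, numFaces Δ' (#A + i) = numFaces Δ (#A + i) + numFaces S i) ∧
      ∀ i < #A, numFaces Δ' i = numFaces Δ i := by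
  have hS : ∀ H ∈ S, H ⊆ W := fun H hH =>
    subset_union_right.trans (hW _ ((hnew (A ∪ H)).2 ⟨H, hH, rfl⟩).1)
  have hW' : ∀ F ∈ Δ, F ⊆ W := fun F hF => hW F (hle hF)
  have split (i : ℕ) : numFaces Δ' i = numFaces Δ i +
      #((W.powersetCard i).filter fun F => F ∈ Δ' ∧ F ∉ Δ) := by
    rw [numFaces_eq_card_filter hW, numFaces_eq_card_filter hW', ← card_union_of_disjoint]
    · congr 1
      ext F
      simp only [mem_union, mem_filter]
      by_cases h : F ∈ Δ
      · have h' : F ∈ Δ' := hle h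
        simp [h, h']
      · simp [h]
    · rw [disjoint_filter]
      exact fun F _ h1 h2 => h2.2 h1
  refine ⟨fun i => ?_, fun i hi => ?_⟩
  · rw [split, numFaces_eq_card_filter hS]
    congr 1
    symm
    refine card_bij (fun H _ => A ∪ H) ?_ ?_ ?_
    · intro H hH
      rw [mem_filter, mem_powersetCard] at hH ⊢
      have := (hnew (A ∪ H)).2 ⟨H, hH.2, rfl⟩
      exact ⟨⟨hW _ this.1, by rw [card_union_of_disjoint (hdisj H hH.2), hH.1.2]⟩, this⟩
    · intro H hH H' hH' heq
      rw [mem_filter] at hH hH'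
      rw [← union_sdiff_cancel_left (hdisj H hH.2), ← union_sdiff_cancel_left (hdisj H' hH'.2)]
      exact congrArg (· \ A) heq
    · intro F hF
      rw [mem_filter, mem_powersetCard] at hF
      obtain ⟨H, hH, rfl⟩ := (hnew F).1 hF.2
      refine ⟨H, ?_, rfl⟩
      have h2 := hF.1.2
      rw [card_union_of_disjoint (hdisj H hH)] at h2
      rw [mem_filter, mem_powersetCard]
      exact ⟨⟨hS H hH, by omega⟩, hH⟩
  · rw [split, filter_false_of_mem, card_empty, add_zero]
    intro F hF hF'
    obtain ⟨H, -, rfl⟩ := (hnew F).1 hF'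
    have h2 := (mem_powersetCard.1 hF).2
    have := card_le_card (subset_union_left : A ⊆ A ∪ H)
    omega

/-! ### Joins -/

theorem mem_join {K L : SimpComplex V} {F : Finset V} :
    F ∈ join K L ↔ ∃ G ∈ K, ∃ H ∈ L, F = G ∪ H := Iff.rfl

theorem mem_simplex {A F : Finset V} : F ∈ simplex A ↔ F ⊆ A := Iff.rfl

theorem mem_simplexBoundary {A F : Finset V} : F ∈ simplexBoundary A ↔ F ⊂ A := Iff.rfl

theorem join_comm (K L : SimpComplex V) : join K L = join L K := by
  ext F
  exact ⟨fun ⟨G, hG, H, hH, h⟩ => ⟨H, hH, G, hG, by rw [h, union_comm]⟩,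
    fun ⟨G, hG, H, hH, h⟩ => ⟨H, hH, G, hG, by rw [h, union_comm]⟩⟩

theorem join_simplex_empty (K : SimpComplex V) : join K (simplex ∅) = K := by
  ext F
  constructor
  · rintro ⟨G, hG, H, hH, rfl⟩
    rwa [subset_empty.1 (mem_simplex.1 hH), union_empty]
  · exact fun h => ⟨F, h, ∅, mem_simplex.2 le_rfl, by simp⟩

theorem simplexBoundary_eq_of_card_eq_one {A : Finset V} (hA : #A = 1) :
    simplexBoundary A = simplex ∅ := by
  obtain ⟨x, rfl⟩ := Finset.card_eq_one.1 hA
  ext F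
  exact mem_simplexBoundary.trans (ssubset_singleton_iff.trans subset_empty.symm)

theorem numFaces_join {K L : SimpComplex V} {U U' : Finset V} (hK : ∀ F ∈ K, F ⊆ U)
    (hL : ∀ F ∈ L, F ⊆ U') (hd : Disjoint U U') (i : ℕ) :
    numFaces (join K L) i = ∑ p ∈ antidiagonal i, numFaces K p.1 * numFaces L p.2 := by
  have hJ : ∀ F ∈ join K L, F ⊆ U ∪ U' := by
    rintro F ⟨G, hG, H, hH, rfl⟩
    exact union_subset_union (hK G hG) (hL H hH)
  rw [numFaces_eq_card_filter hJ]
  have : ∀ p ∈ antidiagonal i, numFaces K p.1 * numFaces L p.2 =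
      #(((U.powersetCard p.1).filter fun F => F ∈ K) ×ˢ
        ((U'.powersetCard p.2).filter fun F => F ∈ L)) := fun p _ => by
    rw [card_product, numFaces_eq_card_filter hK, numFaces_eq_card_filter hL]
  rw [sum_congr rfl this, ← card_sigma]
  symm
  have recover : ∀ G ∈ K, ∀ H ∈ L, (G ∪ H) ∩ U = G ∧ (G ∪ H) ∩ U' = H := by
    intro G hG H hH
    rw [union_inter_distrib_right, union_inter_distrib_right, inter_eq_left.2 (hK G hG),
      inter_eq_left.2 (hL H hH), disjoint_iff_inter_eq_empty.1 (hd.symm.mono_left (hL H hH)),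
      disjoint_iff_inter_eq_empty.1 (hd.mono_left (hK G hG))]
    simp
  refine card_bij (fun x _ => x.2.1 ∪ x.2.2) ?_ ?_ ?_
  · rintro ⟨⟨p, q⟩, G, H⟩ hx
    simp only [mem_sigma, HasAntidiagonal.mem_antidiagonal, mem_product, mem_filter, mem_powersetCard] at hx ⊢
    obtain ⟨rfl, ⟨⟨hG1, rfl⟩, hG3⟩, ⟨hH1, rfl⟩, hH3⟩ := hx
    exact ⟨⟨union_subset_union hG1 hH1, card_union_of_disjoint
      (disjoint_of_subset_left hG1 (disjoint_of_subset_right hH1 hd))⟩, G, hG3, H, hH3, rfl⟩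
  · rintro ⟨⟨p, q⟩, G, H⟩ hx ⟨⟨p', q'⟩, G', H'⟩ hx' heq
    simp only [mem_sigma, HasAntidiagonal.mem_antidiagonal, mem_product, mem_filter, mem_powersetCard] at hx hx'
    obtain ⟨-, ⟨⟨-, rfl⟩, hG3⟩, ⟨-, rfl⟩, hH3⟩ := hx
    obtain ⟨-, ⟨⟨-, rfl⟩, hG3'⟩, ⟨-, rfl⟩, hH3'⟩ := hx'
    have e1 := recover G hG3 H hH3
    have e2 := recover G' hG3' H' hH3'
    have heq' : G ∪ H = G' ∪ H' := heq
    rw [heq'] at e1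
    obtain rfl : G = G' := e1.1.symm.trans e2.1
    obtain rfl : H = H' := e1.2.symm.trans e2.2
    rfl
  · intro F hF
    rw [mem_filter, mem_powersetCard] at hF
    obtain ⟨⟨-, hc⟩, G, hG, H, hH, rfl⟩ := hF
    refine ⟨⟨(#G, #H), G, H⟩, ?_, rfl⟩
    simp only [mem_sigma, HasAntidiagonal.mem_antidiagonal, mem_product, mem_filter, mem_powersetCard]
    refine ⟨?_, ⟨⟨hK G hG, trivial⟩, hG⟩, ⟨hL H hH, trivial⟩, hH⟩
    rw [← hc, card_union_of_disjoint
      (disjoint_of_subset_left (hK G hG) (disjoint_of_subset_right (hL H hH) hd))]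

theorem numFaces_simplex (A : Finset V) (i : ℕ) : numFaces (simplex A) i = (#A).choose i := by
  rw [numFaces_eq_card_filter (W := A) (fun F hF => hF), filter_true_of_mem, card_powersetCard]
  exact fun F hF => (mem_powersetCard.1 hF).1

theorem numFaces_simplexBoundary (A : Finset V) (i : ℕ) :
    numFaces (simplexBoundary A) i = if i < #A then (#A).choose i else 0 := by
  rw [numFaces_eq_card_filter (W := A) (fun F hF => (mem_simplexBoundary.1 hF).subset)]
  split_ifs with h
  · rw [filter_true_of_mem, card_powersetCard]
    intro F hF
    rw [mem_powersetCard] at hF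
    exact mem_simplexBoundary.2 (hF.1.ssubset_of_ne (by rintro rfl; omega))
  · rw [filter_false_of_mem, card_empty]
    intro F hF hF'
    have := card_lt_card (mem_simplexBoundary.1 hF')
    rw [mem_powersetCard] at hF
    omega

/-! ### PS spheres -/

theorem mem_joinOfBoundaries_support {l : List (Finset V)} {F : Finset V}
    (hF : F ∈ joinOfBoundaries l) {x : V} (hx : x ∈ F) : ∃ A ∈ l, x ∈ A := by
  induction l generalizing F with
  | nil => exact absurd (mem_simplex.1 hF hx) (notMem_empty x)
  | cons A l ih =>
    obtain ⟨G, hG, H, hH, rfl⟩ := hF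
    rcases mem_union.1 hx with hx | hx
    · exact ⟨A, by simp, (mem_simplexBoundary.1 hG).subset hx⟩
    · obtain ⟨B, hB, hxB⟩ := ih hH hx
      exact ⟨B, by simp [hB], hxB⟩

theorem joinOfBoundaries_cons (A : Finset V) (l : List (Finset V)) :
    joinOfBoundaries (A :: l) = join (simplexBoundary A) (joinOfBoundaries l) := rfl

theorem joinOfBoundaries_nil : joinOfBoundaries ([] : List (Finset V)) = simplex ∅ := rfl

/-- The boundary of a vertex is {∅}, the unit for joins, so one-element sets can be dropped. All
remaining factors then have dimension at least 0, which leaves few cases in low dimension. -/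
theorem IsPSSphere.exists_two_le_card {S : SimpComplex V} (hS : IsPSSphere S) :
    ∃ l : List (Finset V), (∀ A ∈ l, 2 ≤ #A) ∧ l.Pairwise Disjoint ∧ S = joinOfBoundaries l := by
  obtain ⟨l, hne, hd, rfl⟩ := hS
  refine ⟨l.filter fun A => 2 ≤ #A, fun A hA => by simpa using (List.mem_filter.1 hA).2,
    hd.sublist List.filter_sublist, ?_⟩
  clear hd
  induction l with
  | nil => rfl
  | cons A l ih =>
    have hpos := card_pos.2 (hne A (by simp))
    have ih := ih fun B hB => hne B (by simp [hB])
    rcases Nat.lt_or_ge (#A) 2 with hA | hA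
    · rw [List.filter_cons_of_neg (by simpa using hA), joinOfBoundaries_cons,
        simplexBoundary_eq_of_card_eq_one (by omega), join_comm, join_simplex_empty, ih]
    · rw [List.filter_cons_of_pos (by simpa using hA), joinOfBoundaries_cons,
        joinOfBoundaries_cons, ih]

theorem empty_mem_joinOfBoundaries {l : List (Finset V)} (hl : ∀ A ∈ l, 2 ≤ #A) :
    ∅ ∈ joinOfBoundaries l := by
  induction l with
  | nil => exact mem_simplex.2 le_rfl
  | cons A l ih =>
    have hA := hl A (by simp)
    refine ⟨∅, mem_simplexBoundary.2 ?_, ∅, ih fun B hB => hl B (by simp [hB]), by simp⟩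
    exact (card_pos.1 (by omega : 0 < #A)).empty_ssubset

theorem singleton_mem_simplexBoundary {A : Finset V} (hA : 2 ≤ #A) {x : V} (hx : x ∈ A) :
    {x} ∈ simplexBoundary A := by
  refine mem_simplexBoundary.2 ((singleton_subset_iff.2 hx).ssubset_of_ne ?_)
  rintro rfl
  simp at hA

theorem card_le_of_mem_joinOfBoundaries {l : List (Finset V)} {F : Finset V}
    (hF : F ∈ joinOfBoundaries l) : #F ≤ (l.map fun A => #A - 1).sum := by
  induction l generalizing F with
  | nil => simp [subset_empty.1 (mem_simplex.1 hF)]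
  | cons A l ih =>
    obtain ⟨G, hG, H, hH, rfl⟩ := hF
    have h1 := card_lt_card (mem_simplexBoundary.1 hG)
    have h2 := ih hH
    have h3 := card_union_le G H
    simp only [List.map_cons, List.sum_cons]
    omega

theorem exists_card_eq_of_joinOfBoundaries {l : List (Finset V)} (hl : ∀ A ∈ l, 2 ≤ #A)
    (hd : l.Pairwise Disjoint) :
    ∃ F ∈ joinOfBoundaries l, #F = (l.map fun A => #A - 1).sum := by
  induction l with
  | nil => exact ⟨∅, mem_simplex.2 le_rfl, by simp⟩
  | cons A l ih =>
    rw [List.pairwise_cons] at hd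
    obtain ⟨H, hH, hc⟩ := ih (fun B hB => hl B (by simp [hB])) hd.2
    have hA := hl A (by simp)
    obtain ⟨x, hx⟩ := card_pos.1 (by omega : 0 < #A)
    refine ⟨A.erase x ∪ H, ⟨A.erase x, mem_simplexBoundary.2 (erase_ssubset hx), H, hH, rfl⟩, ?_⟩
    rw [card_union_of_disjoint, card_erase_of_mem hx, hc, List.map_cons, List.sum_cons]
    rw [disjoint_left]
    intro y hy hyH
    obtain ⟨B, hB, hyB⟩ := mem_joinOfBoundaries_support hH hyH
    exact disjoint_left.1 (hd.1 B hB) (mem_of_mem_erase hy) hyB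

theorem HasDim.card_le {Δ : SimpComplex V} (h : HasDim Δ 2) {F : Finset V} (hF : F ∈ Δ) :
    #F ≤ 3 := by
  have := h.2 ⟨F, hF, rfl⟩
  omega

theorem HasDim.exists_card {Δ : SimpComplex V} (h : HasDim Δ 2) : ∃ F ∈ Δ, #F = 3 := by
  obtain ⟨F, hF, h⟩ := h.1
  exact ⟨F, hF, by omega⟩

theorem numFaces_join_simplexBoundary {A B : Finset V} (h : Disjoint A B) (i : ℕ) :
    numFaces (join (simplexBoundary A) (simplexBoundary B)) i =
      ∑ p ∈ antidiagonal i,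
        (if p.1 < #A then (#A).choose p.1 else 0) * if p.2 < #B then (#B).choose p.2 else 0 := by
  rw [numFaces_join (fun F hF => (mem_simplexBoundary.1 hF).subset)
    (fun F hF => (mem_simplexBoundary.1 hF).subset) h]
  simp only [numFaces_simplexBoundary]

/-- Only the 3-cycle and the 4-cycle occur. At most four vertices is what makes 2 f_0 ≤ f_1 + 4
hold, as coning off the cycle requires. -/
theorem numFaces_one_sphere {l : List (Finset V)} (hl : ∀ A ∈ l, 2 ≤ #A) (hd : l.Pairwise Disjoint)
    (hsum : (l.map fun A => #A - 1).sum = 2) :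
    3 ≤ numFaces (joinOfBoundaries l) 1 ∧
      numFaces (joinOfBoundaries l) 1 = numFaces (joinOfBoundaries l) 2 ∧
      numFaces (joinOfBoundaries l) 1 ≤ 4 := by
  match l with
  | [] => simp at hsum
  | [A] =>
    simp only [List.map_cons, List.map_nil, List.sum_cons, List.sum_nil] at hsum
    have hA : #A = 3 := by omega
    rw [joinOfBoundaries_cons, joinOfBoundaries_nil, join_simplex_empty, numFaces_simplexBoundary,
      numFaces_simplexBoundary, hA]
    decide
  | [A, B] =>
    simp only [List.map_cons, List.map_nil, List.sum_cons, List.sum_nil] at hsum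
    have h1 := hl A (by simp)
    have h2 := hl B (by simp)
    have hA : #A = 2 := by omega
    have hB : #B = 2 := by omega
    have hAB : Disjoint A B := by simpa using hd
    rw [joinOfBoundaries_cons, joinOfBoundaries_cons, joinOfBoundaries_nil, join_simplex_empty,
      numFaces_join_simplexBoundary hAB, numFaces_join_simplexBoundary hAB, hA, hB]
    decide
  | A :: B :: C :: l =>
    have h1 := hl A (by simp)
    have h2 := hl B (by simp)
    have h3 := hl C (by simp)
    simp only [List.map_cons, List.sum_cons] at hsum
    omega

theorem numFaces_zero_sphere {l : List (Finset V)} (hl : ∀ A ∈ l, 2 ≤ #A)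
    (hsum : (l.map fun A => #A - 1).sum = 1) : numFaces (joinOfBoundaries l) 1 = 2 := by
  match l with
  | [] => simp at hsum
  | [A] =>
    simp only [List.map_cons, List.map_nil, List.sum_cons, List.sum_nil] at hsum
    have hA : #A = 2 := by omega
    rw [joinOfBoundaries_cons, joinOfBoundaries_nil, join_simplex_empty, numFaces_simplexBoundary,
      hA]
    decide
  | A :: B :: l =>
    have h1 := hl A (by simp)
    have h2 := hl B (by simp)
    simp only [List.map_cons, List.sum_cons] at hsum
    omega

theorem pair_mem_simplexBoundary {A : Finset V} (hA : 3 ≤ #A) {x y : V} (hx : x ∈ A) (hy : y ∈ A) :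
    {x, y} ∈ simplexBoundary A := by
  refine mem_simplexBoundary.2 ((insert_subset hx (singleton_subset_iff.2 hy)).ssubset_of_ne ?_)
  rintro rfl
  have := card_le_two (a := x) (b := y)
  omega

theorem pair_mem_join {K L : SimpComplex V} {x y : V} (hx : {x} ∈ K) (hy : {y} ∈ L) :
    {x, y} ∈ join K L := ⟨{x}, hx, {y}, hy, rfl⟩

theorem left_le_join {K L : SimpComplex V} (h : ∅ ∈ L) : K ≤ join K L :=
  fun F hF => ⟨F, hF, ∅, h, by simp⟩

theorem right_le_join {K L : SimpComplex V} (h : ∅ ∈ K) : L ≤ join K L :=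
  fun F hF => ⟨∅, h, F, hF, by simp⟩

theorem earLike_tetrahedron {A : Finset V} (hA : #A = 4) :
    EarLike (simplexBoundary A) A where
  empty_mem := mem_simplexBoundary.2 (card_pos.1 (by omega : 0 < #A)).empty_ssubset
  singleton_mem x := ⟨fun h => (mem_simplexBoundary.1 h).subset (mem_singleton_self x),
    singleton_mem_simplexBoundary (by omega)⟩
  rigid := by
    have adj : ∀ x ∈ A, ∀ y ∈ A, x ≠ y → (graph (simplexBoundary A)).Adj x y :=
      fun x hx y hy hxy => ⟨hxy, pair_mem_simplexBoundary (by omega) hx hy⟩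
    obtain ⟨d, T, hd, rfl, hT⟩ := card_eq_succ.1 hA
    obtain ⟨a, b, c, hab, hac, hbc, rfl⟩ := card_eq_three.1 hT
    simp only [mem_insert, mem_singleton, not_or] at hd
    refine .insert _ d (.triangle a b c (adj a ?_ b ?_ hab) (adj a ?_ c ?_ hac)
      (adj b ?_ c ?_ hbc)) ?_ (three_le_card_filter (a := a) (b := b) (c := c) ?_ ?_ ?_ hab hac hbc
      (adj d ?_ a ?_ hd.1) (adj d ?_ b ?_ hd.2.1) (adj d ?_ c ?_ hd.2.2))
    all_goals simp [hd]
  four_le := by omega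
  edges_le := by
    rw [numFaces_simplexBoundary, numFaces_simplexBoundary, hA]
    decide
  edges_le' := by
    rw [numFaces_simplexBoundary, numFaces_simplexBoundary, hA]
    decide

theorem earLike_bipyramid {A B : Finset V} (hA : #A = 3) (hB : #B = 2) (hAB : Disjoint A B) :
    EarLike (join (simplexBoundary A) (simplexBoundary B)) (A ∪ B) := by
  have eA : ∅ ∈ simplexBoundary A :=
    mem_simplexBoundary.2 (card_pos.1 (by omega : 0 < #A)).empty_ssubset
  have eB : ∅ ∈ simplexBoundary B :=
    mem_simplexBoundary.2 (card_pos.1 (by omega : 0 < #B)).empty_ssubset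
  have hcard : #(A ∪ B) = 5 := by rw [card_union_of_disjoint hAB]; omega
  refine ⟨left_le_join eB eA, fun x => ⟨?_, fun hx => ?_⟩, ?_, by omega, ?_, ?_⟩
  · rintro ⟨G, hG, H, hH, h⟩
    have : x ∈ G ∪ H := by rw [← h]; simp
    exact union_subset_union (mem_simplexBoundary.1 hG).subset (mem_simplexBoundary.1 hH).subset this
  · rcases mem_union.1 hx with hx | hx
    · exact left_le_join eB (singleton_mem_simplexBoundary (by omega) hx)
    · exact right_le_join eA (singleton_mem_simplexBoundary (by omega) hx)
  · set G := graph (join (simplexBoundary A) (simplexBoundary B))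
    have adj : ∀ x ∈ A, ∀ y ∈ A, x ≠ y → G.Adj x y := fun x hx y hy hxy =>
      ⟨hxy, left_le_join eB (pair_mem_simplexBoundary (by omega) hx hy)⟩
    have adj' : ∀ y ∈ B, ∀ x ∈ A, G.Adj y x := fun y hy x hx =>
      SimpleGraph.Adj.symm ⟨fun h => disjoint_left.1 hAB hx (h ▸ hy),
        pair_mem_join (singleton_mem_simplexBoundary (by omega) hx)
          (singleton_mem_simplexBoundary (by omega) hy)⟩
    obtain ⟨a, b, c, hab, hac, hbc, rfl⟩ := card_eq_three.1 hA
    obtain ⟨d, e, hde, rfl⟩ := card_eq_two.1 hB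
    have hd : d ∉ ({a, b, c} : Finset V) := disjoint_right.1 hAB (by simp)
    have he : e ∉ ({a, b, c} : Finset V) := disjoint_right.1 hAB (by simp)
    have h1 : Rigid G {a, b, c} := by
      refine .triangle a b c (adj a ?_ b ?_ hab) (adj a ?_ c ?_ hac) (adj b ?_ c ?_ hbc)
      all_goals simp
    have h2 : Rigid G (insert d {a, b, c}) := by
      refine .insert _ d h1 hd (three_le_card_filter (a := a) (b := b) (c := c) ?_ ?_ ?_ hab hac hbc
        (adj' d ?_ a ?_) (adj' d ?_ b ?_) (adj' d ?_ c ?_))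
      all_goals simp
    have h3 : Rigid G (insert e (insert d {a, b, c})) := by
      refine .insert _ e h2 (by rw [mem_insert, not_or]; exact ⟨hde.symm, he⟩)
        (three_le_card_filter (a := a) (b := b) (c := c) ?_ ?_ ?_ hab hac hbc
        (adj' e ?_ a ?_) (adj' e ?_ b ?_) (adj' e ?_ c ?_))
      all_goals simp
    convert h3 using 1
    ext x
    simp only [mem_union, mem_insert, mem_singleton]
    tauto
  · rw [numFaces_join_simplexBoundary hAB, numFaces_join_simplexBoundary hAB, hcard, hA, hB]
    decide
  · rw [numFaces_join_simplexBoundary hAB, numFaces_join_simplexBoundary hAB, hA, hB]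
    decide

theorem earLike_octahedron {A B C : Finset V} (hA : #A = 2) (hB : #B = 2) (hC : #C = 2)
    (hAB : Disjoint A B) (hAC : Disjoint A C) (hBC : Disjoint B C) :
    EarLike (join (simplexBoundary A) (join (simplexBoundary B) (simplexBoundary C)))
      (A ∪ (B ∪ C)) := by
  have eA : ∅ ∈ simplexBoundary A :=
    mem_simplexBoundary.2 (card_pos.1 (by omega : 0 < #A)).empty_ssubset
  have eB : ∅ ∈ simplexBoundary B :=
    mem_simplexBoundary.2 (card_pos.1 (by omega : 0 < #B)).empty_ssubset
  have eC : ∅ ∈ simplexBoundary C :=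
    mem_simplexBoundary.2 (card_pos.1 (by omega : 0 < #C)).empty_ssubset
  have sA : ∀ x ∈ A, {x} ∈ simplexBoundary A :=
    fun x hx => singleton_mem_simplexBoundary (by omega) hx
  have sB : ∀ x ∈ B, {x} ∈ simplexBoundary B :=
    fun x hx => singleton_mem_simplexBoundary (by omega) hx
  have sC : ∀ x ∈ C, {x} ∈ simplexBoundary C :=
    fun x hx => singleton_mem_simplexBoundary (by omega) hx
  have hABC : Disjoint A (B ∪ C) := disjoint_union_right.2 ⟨hAB, hAC⟩
  have hcard : #(A ∪ (B ∪ C)) = 6 := by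
    rw [card_union_of_disjoint hABC, card_union_of_disjoint hBC]; omega
  have hsub : ∀ F ∈ join (simplexBoundary B) (simplexBoundary C), F ⊆ B ∪ C := by
    rintro F ⟨G, hG, H, hH, rfl⟩
    exact union_subset_union (mem_simplexBoundary.1 hG).subset (mem_simplexBoundary.1 hH).subset
  have hnum (i : ℕ) := numFaces_join (K := simplexBoundary A) (U := A)
    (fun F hF => (mem_simplexBoundary.1 hF).subset) hsub hABC i
  simp only [numFaces_join_simplexBoundary hBC, numFaces_simplexBoundary, hA, hB, hC] at hnum
  refine ⟨left_le_join (left_le_join eC eB) eA, fun x => ⟨?_, fun hx => ?_⟩, ?_, by omega, ?_, ?_⟩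
  · rintro ⟨G, hG, H, hH, h⟩
    have : x ∈ G ∪ H := by rw [← h]; simp
    exact union_subset_union (mem_simplexBoundary.1 hG).subset (hsub H hH) this
  · rcases mem_union.1 hx with hx | hx
    · exact left_le_join (left_le_join eC eB) (sA x hx)
    · refine right_le_join eA ?_
      rcases mem_union.1 hx with hx | hx
      · exact left_le_join eC (sB x hx)
      · exact right_le_join eB (sC x hx)
  · set G := graph (join (simplexBoundary A) (join (simplexBoundary B) (simplexBoundary C)))
    have adjAB : ∀ x ∈ A, ∀ y ∈ B, G.Adj x y := fun x hx y hy =>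
      ⟨fun h => disjoint_left.1 hAB hx (h ▸ hy), pair_mem_join (sA x hx) (left_le_join eC (sB y hy))⟩
    have adjAC : ∀ x ∈ A, ∀ y ∈ C, G.Adj x y := fun x hx y hy =>
      ⟨fun h => disjoint_left.1 hAC hx (h ▸ hy),
        pair_mem_join (sA x hx) (right_le_join eB (sC y hy))⟩
    have adjBC : ∀ x ∈ B, ∀ y ∈ C, G.Adj x y := fun x hx y hy =>
      ⟨fun h => disjoint_left.1 hBC hx (h ▸ hy),
        right_le_join eA (pair_mem_join (sB x hx) (sC y hy))⟩
    obtain ⟨a, a', ha, rfl⟩ := card_eq_two.1 hA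
    obtain ⟨b, b', hb, rfl⟩ := card_eq_two.1 hB
    obtain ⟨c, c', hc, rfl⟩ := card_eq_two.1 hC
    have := Rigid.of_octahedron (G := G) ha hb hc
      (adjAB a (by simp) b (by simp)) (adjAB a (by simp) b' (by simp))
      (adjAB a' (by simp) b (by simp)) (adjAB a' (by simp) b' (by simp))
      (adjAC a (by simp) c (by simp)) (adjAC a (by simp) c' (by simp))
      (adjAC a' (by simp) c (by simp)) (adjAC a' (by simp) c' (by simp))
      (adjBC b (by simp) c (by simp)) (adjBC b (by simp) c' (by simp))
      (adjBC b' (by simp) c (by simp)) (adjBC b' (by simp) c' (by simp))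
    simpa only [insert_union, singleton_union] using this
  · rw [hnum, hnum, hcard]
    decide
  · rw [hnum, hnum]
    decide

/-- A two-dimensional sphere has factor dimensions |A_i| - 1 adding up to 3 with each at least 1:
the partitions 3, 2+1 and 1+1+1 give tetrahedron, bipyramid and octahedron. -/
theorem IsPSSphere.earLike {S : SimpComplex V} (hS : IsPSSphere S) (hdim : HasDim S 2) :
    ∃ W, EarLike S W := by
  obtain ⟨l, hl, hd, rfl⟩ := hS.exists_two_le_card
  obtain ⟨F, hF, hFc⟩ := hdim.exists_card
  obtain ⟨F', hF', hFc'⟩ := exists_card_eq_of_joinOfBoundaries hl hd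
  have h1 := card_le_of_mem_joinOfBoundaries hF
  have h2 := hdim.card_le hF'
  have hsum : (l.map fun A => #A - 1).sum = 3 := by omega
  clear hFc' hFc h1 h2 hF hF' hS hdim
  match l with
  | [] => simp at hsum
  | [A] =>
    simp only [List.map_cons, List.map_nil, List.sum_cons, List.sum_nil] at hsum
    rw [joinOfBoundaries_cons, joinOfBoundaries_nil, join_simplex_empty]
    exact ⟨A, earLike_tetrahedron (by omega)⟩
  | [A, B] =>
    simp only [List.map_cons, List.map_nil, List.sum_cons, List.sum_nil] at hsum
    have h1 := hl A (by simp)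
    have h2 := hl B (by simp)
    have hAB : Disjoint A B := by simpa using hd
    rw [joinOfBoundaries_cons, joinOfBoundaries_cons, joinOfBoundaries_nil, join_simplex_empty]
    rcases (by omega : #A = 3 ∧ #B = 2 ∨ #A = 2 ∧ #B = 3) with h | h
    · exact ⟨_, earLike_bipyramid h.1 h.2 hAB⟩
    · rw [join_comm]
      exact ⟨_, earLike_bipyramid h.2 h.1 hAB.symm⟩
  | [A, B, C] =>
    simp only [List.map_cons, List.map_nil, List.sum_cons, List.sum_nil] at hsum
    have h1 := hl A (by simp)
    have h2 := hl B (by simp)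
    have h3 := hl C (by simp)
    simp only [List.pairwise_cons, List.mem_cons, List.not_mem_nil, or_false, forall_eq_or_imp,
      forall_eq, IsEmpty.forall_iff, implies_true, List.Pairwise.nil, and_true] at hd
    rw [joinOfBoundaries_cons, joinOfBoundaries_cons, joinOfBoundaries_cons, joinOfBoundaries_nil,
      join_simplex_empty]
    exact ⟨_, earLike_octahedron (by omega) (by omega) (by omega) hd.1.1 hd.1.2 hd.2⟩
  | A :: B :: C :: D :: l =>
    have h1 := hl A (by simp)
    have h2 := hl B (by simp)
    have h3 := hl C (by simp)
    have h4 := hl D (by simp)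
    simp only [List.map_cons, List.sum_cons] at hsum
    omega

/-! ### Attaching ears -/

/-- Attaching faces `{w} ∪ H` for a new vertex `w` and `H` in a complex `S` with enough faces. -/
theorem EarLike.attach_vertex {Δ Δ' S : SimpComplex V} {W : Finset V} {w : V} (h : EarLike Δ W)
    (hle : Δ ≤ Δ') (hnew : ∀ F, F ∈ Δ' ∧ F ∉ Δ ↔ ∃ H ∈ S, F = {w} ∪ H)
    (hS : S ≤ Δ) (hempty : ∅ ∈ S) (h1 : 3 ≤ numFaces S 1) (h2 : 2 * numFaces S 1 ≤ numFaces S 2 + 4)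
    (h3 : numFaces S 1 ≤ numFaces S 2) : EarLike Δ' (insert w W) := by
  have hw' : {w} ∈ Δ' ∧ {w} ∉ Δ := (hnew {w}).2 ⟨∅, hempty, by simp⟩
  have hwW : w ∉ W := fun hw => hw'.2 ((h.singleton_mem w).2 hw)
  have hSW : ∀ H ∈ S, H ⊆ W := fun H hH => subset_of_forall_singleton_mem h.singleton_mem (hS hH)
  have hsing : ∀ x, {x} ∈ Δ' ↔ x ∈ insert w W := by
    intro x
    rw [mem_insert, ← h.singleton_mem]
    by_cases hx : {x} ∈ Δ
    · have hx' : {x} ∈ Δ' := hle hx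
      simp [hx, hx']
    · simp only [hx, or_false]
      constructor
      · intro hx'
        obtain ⟨H, -, hH⟩ := (hnew {x}).1 ⟨hx', hx⟩
        have : w ∈ ({x} : Finset V) := by rw [hH]; simp
        exact (mem_singleton.1 this).symm
      · rintro rfl
        exact hw'.1
  have hnum := (numFaces_attach hle (fun F => subset_of_forall_singleton_mem hsing) hnew
    fun H hH => disjoint_singleton_left.2 fun hwH => hwW (hSW H hH hwH)).1
  have n2 := hnum 1
  have n3 := hnum 2
  simp only [card_singleton, Nat.reduceAdd] at n2 n3
  have e1 := h.edges_le
  have e2 := h.edges_le'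
  have e3 := h.four_le
  refine ⟨hle h.empty_mem, hsing, .insert _ _ (h.rigid.mono (graph_mono hle)) hwW ?_, ?_, ?_, ?_⟩
  · rw [numFaces_eq_card_filter hSW] at h1
    refine h1.trans ?_
    rw [← card_image_of_injective _ (singleton_injective (α := V))]
    refine card_le_card fun F hF => ?_
    rw [mem_filter, mem_powersetCard] at hF
    obtain ⟨⟨hFW, hFc⟩, hFS⟩ := hF
    obtain ⟨x, rfl⟩ := card_eq_one.1 hFc
    rw [singleton_subset_iff] at hFW
    refine mem_image_of_mem _ (mem_filter.2 ⟨hFW, ?_, ?_⟩)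
    · rintro rfl
      exact hwW hFW
    · exact ((hnew _).2 ⟨{x}, hFS, rfl⟩).1
  · rw [card_insert_of_notMem hwW]; omega
  · rw [card_insert_of_notMem hwW]; omega
  · omega

/-- Because the ball meets Δ in ∂A * S, the new faces are A ∪ H with H in S. For |A| = 3 this adds a
triangle, for |A| = 2 an edge and two triangles, and for |A| = 1 a vertex coned over a 3- or
4-cycle; both face inequalities survive in each case. -/
theorem EarLike.attach_ball {Δ B : SimpComplex V} {W : Finset V} (h : EarLike Δ W)
    (hdim : HasDim B 2) (hB : IsPSBallWithBoundary B (B ⊓ Δ)) : ∃ W', EarLike (Δ ⊔ B) W' := by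
  obtain ⟨A, S, hA, hS, hdisj, rfl, hC⟩ := hB
  obtain ⟨l, hl, hd, rfl⟩ := hS.exists_two_le_card
  set S := joinOfBoundaries l with hSdef
  have hempty : ∅ ∈ S := empty_mem_joinOfBoundaries hl
  have hApos := card_pos.2 hA
  have hsum : #A + (l.map fun A => #A - 1).sum = 3 := by
    obtain ⟨F, ⟨G, hG, H, hH, rfl⟩, hFc⟩ := hdim.exists_card
    obtain ⟨H', hH', hc'⟩ := exists_card_eq_of_joinOfBoundaries hl hd
    have h1 := card_le_of_mem_joinOfBoundaries hH
    have h2 := card_le_card (mem_simplex.1 hG)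
    have h3 := card_union_le G H
    have h4 := hdim.card_le (F := A ∪ H') ⟨A, mem_simplex.2 le_rfl, H', hH', rfl⟩
    rw [card_union_of_disjoint (hdisj H' hH')] at h4
    omega
  have hle : Δ ≤ Δ ⊔ join (simplex A) S := le_sup_left
  have hSΔ : S ≤ Δ := by
    intro H hH
    have : H ∈ join (simplexBoundary A) S :=
      right_le_join (mem_simplexBoundary.2 hA.empty_ssubset) hH
    rw [← hC] at this
    exact this.2
  have hnew : ∀ F, F ∈ Δ ⊔ join (simplex A) S ∧ F ∉ Δ ↔ ∃ H ∈ S, F = A ∪ H := by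
    intro F
    constructor
    · rintro ⟨hF1 | hF1, hF2⟩
      · exact absurd hF1 hF2
      · obtain ⟨G, hG, H, hH, rfl⟩ := hF1
        refine ⟨H, hH, ?_⟩
        by_contra hne
        have hGA : G ≠ A := by rintro rfl; exact hne rfl
        have : G ∪ H ∈ join (simplexBoundary A) S :=
          ⟨G, mem_simplexBoundary.2 ((mem_simplex.1 hG).ssubset_of_ne hGA), H, hH, rfl⟩
        rw [← hC] at this
        exact hF2 this.2
    · rintro ⟨H, hH, rfl⟩
      have hmem : A ∪ H ∈ join (simplex A) S := ⟨A, mem_simplex.2 le_rfl, H, hH, rfl⟩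
      refine ⟨Or.inr hmem, fun hΔ => ?_⟩
      have : A ∪ H ∈ join (simplexBoundary A) S := by
        rw [← hC]; exact ⟨hmem, hΔ⟩
      -- H' is disjoint from A, so A would have to be contained in its proper subset G.
      obtain ⟨G, hG, H', hH', heq⟩ := this
      have hGA := mem_simplexBoundary.1 hG
      refine hGA.not_subset fun x hx => ?_
      have : x ∈ G ∪ H' := heq ▸ mem_union_left H hx
      exact (mem_union.1 this).resolve_right (disjoint_left.1 (hdisj H' hH') hx)
  rcases Nat.lt_or_ge 1 (#A) with hA1 | hA1
  · have hsing : ∀ x, {x} ∈ Δ ⊔ join (simplex A) S ↔ x ∈ W := by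
      intro x
      rw [← h.singleton_mem]
      refine ⟨fun hx => ?_, fun hx => hle hx⟩
      by_contra hx'
      obtain ⟨H, -, hH⟩ := (hnew {x}).1 ⟨hx, hx'⟩
      have := card_le_card (hH ▸ subset_union_left : A ⊆ {x})
      rw [card_singleton] at this
      omega
    obtain ⟨n1, n2⟩ := numFaces_attach hle (fun F => subset_of_forall_singleton_mem hsing) hnew hdisj
    have hrigid := h.rigid.mono (graph_mono hle)
    have e1 := h.edges_le
    have e2 := h.edges_le'
    have e3 := h.four_le
    have s0 := numFaces_zero hempty
    rcases (by omega : #A = 2 ∨ #A = 3) with hA2 | hA3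
    · have s1 : numFaces S 1 = 2 := numFaces_zero_sphere hl (by omega)
      have m2 := n1 0
      have m3 := n1 1
      rw [hA2] at m2 m3
      simp only [Nat.reduceAdd, add_zero] at m2 m3
      exact ⟨W, hle h.empty_mem, hsing, hrigid, e3, by omega, by omega⟩
    · have m2 := n2 2 (by omega)
      have m3 := n1 0
      rw [hA3] at m3
      simp only [add_zero] at m3
      exact ⟨W, hle h.empty_mem, hsing, hrigid, e3, by omega, by omega⟩
  · obtain ⟨w, rfl⟩ := card_eq_one.1 (by omega : #A = 1)
    rw [card_singleton] at hsum
    have hs : 3 ≤ numFaces S 1 ∧ numFaces S 1 = numFaces S 2 ∧ numFaces S 1 ≤ 4 :=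
      numFaces_one_sphere hl hd (by omega)
    exact ⟨_, h.attach_vertex hle hnew hSΔ hempty (by omega) (by omega) (by omega)⟩

theorem IsPSEarDecomposable.earLike {Δ : SimpComplex V} (h : IsPSEarDecomposable Δ 2) :
    ∃ W, EarLike Δ W := by
  obtain ⟨-, t, E, rfl, ⟨h0, h0'⟩, hE⟩ := h
  suffices ∀ s ≤ t, ∃ W, EarLike (⨆ i, ⨆ (_ : i ≤ s), E i) W from this t le_rfl
  intro s
  induction s with
  | zero =>
    intro _
    have : (⨆ i, ⨆ (_ : i ≤ 0), E i) = E 0 := by simp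
    rw [this]
    exact h0.earLike h0'
  | succ s ih =>
    intro hs
    obtain ⟨W, hW⟩ := ih (by omega)
    obtain ⟨hdim, hball⟩ := hE (s + 1) (by omega) hs
    simp only [Order.lt_add_one_iff] at hball
    obtain ⟨W', hW'⟩ := hW.attach_ball hdim hball
    refine ⟨W', ?_⟩
    convert hW' using 1
    apply le_antisymm
    · refine iSup₂_le fun i hi => ?_
      rcases Nat.le_succ_iff.1 hi with hi | rfl
      · exact le_sup_of_le_left (le_iSup₂_of_le i hi le_rfl)
      · exact le_sup_right
    · refine sup_le (iSup₂_le fun i hi => le_iSup₂_of_le i (by omega) le_rfl)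
        (le_iSup₂_of_le (s + 1) le_rfl le_rfl)

end Complexes

section Matroidal

open Classical

variable {V : Type*}

/-! ### Matroid complexes of rank two -/

/-- Adding the outside vertices one at a time, each brings at least its two edges into W. -/
theorem cliqueCount_two_add_le {G : SimpleGraph V} {W U : Finset V} (hWU : W ⊆ U)
    (h : ∀ y ∈ U, y ∉ W → 2 ≤ #{x ∈ W | G.Adj y x}) :
    cliqueCount G 2 W + 2 * #U ≤ cliqueCount G 2 U + 2 * #W := by
  obtain ⟨R, hd, rfl⟩ : ∃ R, Disjoint W R ∧ U = W ∪ R :=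
    ⟨U \ W, disjoint_sdiff, (union_sdiff_of_subset hWU).symm⟩
  clear hWU
  induction R using Finset.induction_on with
  | empty => simp
  | insert y R hy ih =>
    rw [disjoint_insert_right] at hd
    have hyU : y ∉ W ∪ R := by simp [hd.1, hy]
    have h1 := h y (by simp) hd.1
    have h2 : #{x ∈ W | G.Adj y x} ≤ #{x ∈ W ∪ R | G.Adj y x} :=
      card_le_card (filter_subset_filter _ subset_union_left)
    have h3 := ih hd.2 fun z hz => h z (by
      rw [mem_union] at hz ⊢
      exact hz.imp_right (mem_insert_of_mem))
    rw [union_insert, cliqueCount_two_insert G hyU, card_insert_of_notMem hyU]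
    omega

theorem two_le_card_filter {G : SimpleGraph V} {W : Finset V} {w a b : V} (ha : a ∈ W)
    (hb : b ∈ W) (hab : a ≠ b) (h1 : G.Adj w a) (h2 : G.Adj w b) : 2 ≤ #{x ∈ W | G.Adj w x} :=
  one_lt_card.2 ⟨a, by simp [*], b, by simp [*], hab⟩

/-- Edge bounds for complete multipartite graphs which keep an edge after removing any vertex. -/
theorem edge_bounds_of_cotransitive [Nonempty V] {G : SimpleGraph V} {U : Finset V}
    (hU : ∀ x y, G.Adj x y → x ∈ U)
    (hco : ∀ y ∈ U, ∀ x z, G.Adj x z → G.Adj y x ∨ G.Adj y z)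
    (havoid : ∀ x, ∃ y z, y ≠ x ∧ z ≠ x ∧ G.Adj y z) :
    3 ≤ #U ∧ 2 * #U ≤ cliqueCount G 2 U + 4 ∧ #U ≤ cliqueCount G 2 U := by
  -- Each outside vertex meets every edge of the triangle in a neighbour, hence has two neighbours
  -- among a, b, c. This gives at least 3 + 2(u - 3) edges, where u is the size of U.
  have triangle : ∀ a b c, G.Adj a b → G.Adj a c → G.Adj b c →
      3 ≤ #U ∧ 2 * #U ≤ cliqueCount G 2 U + 4 ∧ #U ≤ cliqueCount G 2 U := by
    intro a b c hab hac hbc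
    have hsub : ({a, b, c} : Finset V) ⊆ U := by
      simp [insert_subset_iff, hU a b hab, hU b c hbc, hU c b hbc.symm]
    have hcard : #({a, b, c} : Finset V) = 3 := by simp [hab.ne, hac.ne, hbc.ne]
    have hcl : cliqueCount G 2 {a, b, c} = 3 := by
      rw [cliqueCount_two_insert G (w := a) (by simp [hab.ne, hac.ne]), cliqueCount_pair G hbc.ne]
      simp [filter_insert, filter_singleton, hab, hac, hbc, hbc.ne]
    have := cliqueCount_two_add_le hsub fun y hy _ => by
      rcases hco y hy a b hab with h1 | h1
      · rcases hco y hy b c hbc with h2 | h2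
        · exact two_le_card_filter (by simp) (by simp) hab.ne h1 h2
        · exact two_le_card_filter (by simp) (by simp) hac.ne h1 h2
      · rcases hco y hy a c hac with h2 | h2
        · exact two_le_card_filter (by simp) (by simp) hab.ne h2 h1
        · exact two_le_card_filter (by simp) (by simp) hbc.ne h1 h2
    have := card_le_card hsub
    omega
  -- Two disjoint edges span at least four edges, and each outside vertex has a neighbour on both.
  -- This gives at least 4 + 2(u - 4) edges, with u ≥ 4.
  have square : ∀ a b c d, G.Adj a b → G.Adj c d → a ≠ c → a ≠ d → b ≠ c → b ≠ d →
      3 ≤ #U ∧ 2 * #U ≤ cliqueCount G 2 U + 4 ∧ #U ≤ cliqueCount G 2 U := by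
    intro a b c d hab hcd hac had hbc hbd
    have hsub : ({a, b, c, d} : Finset V) ⊆ U := by
      simp [insert_subset_iff, hU a b hab, hU b a hab.symm, hU c d hcd, hU d c hcd.symm]
    have hcard : #({a, b, c, d} : Finset V) = 4 := by
      simp [hab.ne, hac, had, hbc, hbd, hcd.ne]
    have hcl : 4 ≤ cliqueCount G 2 {a, b, c, d} := by
      rw [cliqueCount_two_insert G (w := a) (by simp [hab.ne, hac, had]),
        cliqueCount_two_insert G (w := b) (by simp [hbc, hbd]), cliqueCount_pair G hcd.ne,
        if_pos hcd]
      have h1 : 1 ≤ #{x ∈ ({c, d} : Finset V) | G.Adj b x} := by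
        rcases hco b (hU b a hab.symm) c d hcd with h | h
        · exact card_pos.2 ⟨c, by simp [h]⟩
        · exact card_pos.2 ⟨d, by simp [h]⟩
      have h2 : 2 ≤ #{x ∈ ({b, c, d} : Finset V) | G.Adj a x} := by
        rcases hco a (hU a b hab) c d hcd with h | h
        · exact two_le_card_filter (by simp) (by simp) hbc hab h
        · exact two_le_card_filter (by simp) (by simp) hbd hab h
      omega
    have := cliqueCount_two_add_le hsub fun y hy _ => by
      rcases hco y hy a b hab with h1 | h1 <;> rcases hco y hy c d hcd with h2 | h2
      · exact two_le_card_filter (by simp) (by simp) hac h1 h2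
      · exact two_le_card_filter (by simp) (by simp) had h1 h2
      · exact two_le_card_filter (by simp) (by simp) hbc h1 h2
      · exact two_le_card_filter (by simp) (by simp) hbd h1 h2
    have := card_le_card hsub
    omega
  -- An edge avoiding the middle vertex either completes the path to a triangle or is part of a pair
  -- of disjoint edges, so one of the two previous cases applies.
  have path : ∀ y z t, G.Adj y z → G.Adj z t → y ≠ t →
      3 ≤ #U ∧ 2 * #U ≤ cliqueCount G 2 U + 4 ∧ #U ≤ cliqueCount G 2 U := by
    intro y z t hyz hzt hyt
    by_cases hadj : G.Adj y t
    · exact triangle y z t hyz hadj hzt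
    obtain ⟨p, q, hp, hq, hpq⟩ := havoid z
    by_cases hpy : p = y
    · subst hpy
      have hqt : q ≠ t := by rintro rfl; exact hadj hpq
      exact square p q z t hpq hzt hp hyt hq hqt
    by_cases hqy : q = y
    · subst hqy
      have hpt : p ≠ t := by rintro rfl; exact hadj hpq.symm
      exact square q p z t hpq.symm hzt hq hyt hp hpt
    exact square p q y z hpq hyz hpy hp hqy hq
  obtain ⟨y, z, -, -, hyz⟩ := havoid (Classical.arbitrary V)
  obtain ⟨p, q, hp, hq, hpq⟩ := havoid y
  by_cases hpz : p = z
  · subst hpz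
    exact path y p q hyz hpq hq.symm
  by_cases hqz : q = z
  · subst hqz
    exact path y q p hyz hpq.symm hp.symm
  exact square p q y z hpq hyz hp hpz hq hqz

/-- Simplicial complexes of independent sets of matroids: the augmentation property holds. -/
structure Matroidal (Δ : SimpComplex V) : Prop where
  empty_mem : ∅ ∈ Δ
  augment : ∀ I ∈ Δ, ∀ J ∈ Δ, #I < #J → ∃ x ∈ J, x ∉ I ∧ insert x I ∈ Δ

/-- Augmenting a single vertex from a two-element face is exactly the cotransitivity of the graph,
and the absence of coloops gives an edge avoiding any vertex. -/
theorem Matroidal.rank_two_bounds {S : SimpComplex V} (hS : Matroidal S) {X : Finset V}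
    (hX : ∀ F ∈ S, F ⊆ X) (havoid : ∀ x, ∃ B ∈ S, #B = 2 ∧ x ∉ B) [Nonempty V] :
    3 ≤ numFaces S 1 ∧ 2 * numFaces S 1 ≤ numFaces S 2 + 4 ∧ numFaces S 1 ≤ numFaces S 2 ∧
      numFaces S 2 ≤ (numFaces S 1).choose 2 := by
  have hU : ∀ x, {x} ∈ S ↔ x ∈ X.filter fun x => {x} ∈ S := fun x => by
    rw [mem_filter]
    exact ⟨fun h => ⟨singleton_subset_iff.1 (hX _ h), h⟩, fun h => h.2⟩
  rw [numFaces_one hU, numFaces_two hU]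
  have key := edge_bounds_of_cotransitive (G := graph S) (U := X.filter fun x => {x} ∈ S) ?_ ?_ ?_
  · exact ⟨key.1, key.2.1, key.2.2, cliqueCount_le_choose _ _ _⟩
  · intro x y h
    exact (hU x).1 (S.lower (by simp) h.2)
  · intro y hy x z hxz
    obtain ⟨w, hw, hwy, hmem⟩ := hS.augment {y} ((hU y).2 hy) {x, z} hxz.2
      (by rw [card_singleton, card_pair hxz.1]; omega)
    rw [mem_singleton] at hwy
    have hadj : (graph S).Adj y w := ⟨Ne.symm hwy, by rwa [pair_comm]⟩
    rcases mem_insert.1 hw with rfl | hw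
    · exact Or.inl hadj
    · rw [mem_singleton] at hw
      subst hw
      exact Or.inr hadj
  · intro x
    obtain ⟨B, hB, hc, hxB⟩ := havoid x
    obtain ⟨y, z, hyz, rfl⟩ := card_eq_two.1 hc
    simp only [mem_insert, mem_singleton, not_or] at hxB
    exact ⟨y, z, Ne.symm hxB.1, Ne.symm hxB.2, hyz, hB⟩

/-- The faces `F ⊆ X` such that `F ∪ {e}` is a face. -/
def linkIn (Δ : SimpComplex V) (X : Finset V) (e : V) : SimpComplex V where
  carrier := {F | F ⊆ X ∧ insert e F ∈ Δ}
  lower' := fun _ _ h hF => ⟨h.trans hF.1, Δ.lower (insert_subset_insert e h) hF.2⟩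

theorem mem_linkIn {Δ : SimpComplex V} {X F : Finset V} {e : V} :
    F ∈ linkIn Δ X e ↔ F ⊆ X ∧ insert e F ∈ Δ := Iff.rfl

theorem Matroidal.linkIn {Δ : SimpComplex V} (hΔ : Matroidal Δ) {X : Finset V} {e : V}
    (he : e ∉ X) (hmem : {e} ∈ Δ) : Matroidal (linkIn Δ X e) := by
  refine ⟨⟨empty_subset X, by simpa using hmem⟩, fun I hI J hJ hIJ => ?_⟩
  have hI' : e ∉ I := fun h => he (hI.1 h)
  have hJ' : e ∉ J := fun h => he (hJ.1 h)
  obtain ⟨x, hx, hxI, h⟩ := hΔ.augment _ hI.2 _ hJ.2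
    (by rw [card_insert_of_notMem hI', card_insert_of_notMem hJ']; omega)
  rw [mem_insert, not_or] at hxI
  have hxJ : x ∈ J := (mem_insert.1 hx).resolve_left hxI.1
  exact ⟨x, hxJ, hxI.2, insert_subset (hJ.1 hxJ) hI.1, by rwa [Finset.insert_comm]⟩

/-! ### Matroid complexes of rank three without coloops -/

theorem mem_inf_simplex {Δ : SimpComplex V} {X F : Finset V} :
    F ∈ Δ ⊓ simplex X ↔ F ∈ Δ ∧ F ⊆ X := Iff.rfl

/-- A loop changes nothing. Otherwise the new faces form a cone with apex e over its link in X,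
which satisfies the rank-two bounds. -/
theorem Matroidal.earLike_insert {Δ : SimpComplex V} (hΔ : Matroidal Δ) {X W : Finset V} {e : V}
    (he : e ∉ X) (havoid : ∀ x, ∃ B ∈ Δ, #B = 3 ∧ B ⊆ X ∧ x ∉ B)
    (h : EarLike (Δ ⊓ simplex X) W) : ∃ W', EarLike (Δ ⊓ simplex (insert e X)) W' := by
  by_cases hmem : {e} ∈ Δ
  · have hlink := hΔ.linkIn he hmem
    have : Nonempty V := ⟨e⟩
    obtain ⟨h1, h2, h3, -⟩ := hlink.rank_two_bounds (fun F hF => hF.1) fun x => by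
      obtain ⟨B, hB, hBc, hBX, hxB⟩ := havoid x
      -- Extending {e} twice from a basis B ⊆ X that misses x gives a two-element face of the link
      -- that misses x.
      obtain ⟨y, hy, hye, hy'⟩ := hΔ.augment _ hmem _ hB (by rw [card_singleton]; omega)
      have hcard : #(insert y {e}) = 2 := by
        rw [card_insert_of_notMem hye, card_singleton]
      obtain ⟨z, hz, hze, hz'⟩ := hΔ.augment _ hy' _ hB (by omega)
      simp only [mem_insert, mem_singleton, not_or] at hye hze
      refine ⟨{y, z}, ⟨?_, ?_⟩, card_pair (Ne.symm hze.1), ?_⟩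
      · exact insert_subset (hBX hy) (singleton_subset_iff.2 (hBX hz))
      · convert hz' using 1
        ext t
        simp only [mem_insert, mem_singleton]
        tauto
      · simp only [mem_insert, mem_singleton, not_or]
        exact ⟨fun h => hxB (h ▸ hy), fun h => hxB (h ▸ hz)⟩
    refine ⟨_, h.attach_vertex (S := PSEar.linkIn Δ X e) (w := e) ?_ ?_ ?_ hlink.empty_mem h1 h2 h3⟩
    · exact fun F hF => ⟨hF.1, hF.2.trans (subset_insert e X)⟩
    · intro F
      simp only [mem_inf_simplex, mem_linkIn]
      constructor
      · rintro ⟨⟨hF, hFX⟩, hn⟩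
        have heF : e ∈ F := by
          by_contra heF
          exact hn ⟨hF, (subset_insert_iff_of_notMem heF).1 hFX⟩
        refine ⟨F.erase e, ⟨subset_insert_iff.1 hFX, by rwa [insert_erase heF]⟩, ?_⟩
        rw [singleton_union, insert_erase heF]
      · rintro ⟨H, ⟨hHX, hH⟩, rfl⟩
        rw [singleton_union]
        exact ⟨⟨hH, insert_subset_insert e hHX⟩, fun hn => he (hn.2 (mem_insert_self e H))⟩
    · exact fun F hF => ⟨Δ.lower (subset_insert e F) hF.2, hF.1⟩
  · refine ⟨W, ?_⟩
    convert h using 1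
    ext F
    simp only [SetLike.mem_coe, mem_inf_simplex]
    refine and_congr_right fun hF => subset_insert_iff_of_notMem fun heF => hmem ?_
    exact Δ.lower (singleton_subset_iff.2 heF) hF

theorem inf_simplex_eq_tetrahedron {Δ : SimpComplex V} {A : Finset V} (hA : A ∉ Δ)
    (hfacet : ∀ a ∈ A, A.erase a ∈ Δ) : Δ ⊓ simplex A = simplexBoundary A := by
  ext F
  simp only [SetLike.mem_coe, mem_inf_simplex, mem_simplexBoundary]
  constructor
  · rintro ⟨h1, h2⟩
    exact h2.ssubset_of_ne (by rintro rfl; exact hA h1)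
  · intro h
    obtain ⟨a, ha, haF⟩ := exists_of_ssubset h
    exact ⟨Δ.lower (subset_erase.2 ⟨h.subset, haF⟩) (hfacet a ha), h.subset⟩

theorem inf_simplex_eq_join {Δ : SimpComplex V} {A B : Finset V} (hA : A ∉ Δ) (hB : B ∉ Δ)
    (hfacet : ∀ a ∈ A, ∀ b ∈ B, A.erase a ∪ B.erase b ∈ Δ) :
    Δ ⊓ simplex (A ∪ B) = join (simplexBoundary A) (simplexBoundary B) := by
  ext F
  simp only [SetLike.mem_coe, mem_inf_simplex, mem_join, mem_simplexBoundary]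
  constructor
  · rintro ⟨h1, h2⟩
    refine ⟨F ∩ A, inter_subset_right.ssubset_of_ne ?_, F ∩ B, inter_subset_right.ssubset_of_ne ?_,
      by rw [← inter_union_distrib_left, inter_eq_left.2 h2]⟩
    · exact fun h => hA (Δ.lower (inter_eq_right.1 h) h1)
    · exact fun h => hB (Δ.lower (inter_eq_right.1 h) h1)
  · rintro ⟨G, hG, H, hH, rfl⟩
    obtain ⟨a, ha, haG⟩ := exists_of_ssubset hG
    obtain ⟨b, hb, hbH⟩ := exists_of_ssubset hH
    exact ⟨Δ.lower (union_subset_union (subset_erase.2 ⟨hG.subset, haG⟩)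
      (subset_erase.2 ⟨hH.subset, hbH⟩)) (hfacet a ha b hb), union_subset_union hG.subset hH.subset⟩

theorem inf_simplex_eq_join_join {Δ : SimpComplex V} {A B C : Finset V} (hA : A ∉ Δ) (hB : B ∉ Δ)
    (hC : C ∉ Δ)
    (hfacet : ∀ a ∈ A, ∀ b ∈ B, ∀ c ∈ C, A.erase a ∪ (B.erase b ∪ C.erase c) ∈ Δ) :
    Δ ⊓ simplex (A ∪ (B ∪ C)) =
      join (simplexBoundary A) (join (simplexBoundary B) (simplexBoundary C)) := by
  ext F
  simp only [SetLike.mem_coe, mem_inf_simplex, mem_join, mem_simplexBoundary]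
  constructor
  · rintro ⟨h1, h2⟩
    refine ⟨F ∩ A, inter_subset_right.ssubset_of_ne ?_, F ∩ (B ∪ C),
      ⟨F ∩ B, inter_subset_right.ssubset_of_ne ?_, F ∩ C, inter_subset_right.ssubset_of_ne ?_,
        inter_union_distrib_left _ _ _⟩, by rw [← inter_union_distrib_left, inter_eq_left.2 h2]⟩
    · exact fun h => hA (Δ.lower (inter_eq_right.1 h) h1)
    · exact fun h => hB (Δ.lower (inter_eq_right.1 h) h1)
    · exact fun h => hC (Δ.lower (inter_eq_right.1 h) h1)
  · rintro ⟨G, hG, -, ⟨H, hH, K, hK, rfl⟩, rfl⟩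
    obtain ⟨a, ha, haG⟩ := exists_of_ssubset hG
    obtain ⟨b, hb, hbH⟩ := exists_of_ssubset hH
    obtain ⟨c, hc, hcK⟩ := exists_of_ssubset hK
    exact ⟨Δ.lower (union_subset_union (subset_erase.2 ⟨hG.subset, haG⟩)
      (union_subset_union (subset_erase.2 ⟨hH.subset, hbH⟩) (subset_erase.2 ⟨hK.subset, hcK⟩)))
      (hfacet a ha b hb c hc), union_subset_union hG.subset
        (union_subset_union hH.subset hK.subset)⟩

/-- `{a, b, c}` is a face with three different vertices. -/
def IsTriple (Δ : SimpComplex V) (a b c : V) : Prop := a ≠ b ∧ a ≠ c ∧ b ≠ c ∧ {a, b, c} ∈ Δ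

theorem IsTriple.swap_left {Δ : SimpComplex V} {a b c : V} (h : IsTriple Δ a b c) :
    IsTriple Δ b a c :=
  ⟨h.1.symm, h.2.2.1, h.2.1, by rw [Finset.insert_comm]; exact h.2.2.2⟩

theorem IsTriple.swap_right {Δ : SimpComplex V} {a b c : V} (h : IsTriple Δ a b c) :
    IsTriple Δ a c b :=
  ⟨h.2.1, h.1, h.2.2.1.symm, by rw [pair_comm c b]; exact h.2.2.2⟩

theorem IsTriple.adj {Δ : SimpComplex V} {a b c : V} (h : IsTriple Δ a b c) :
    (graph Δ).Adj a b :=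
  ⟨h.1, Δ.lower (by simp [insert_subset_iff]) h.2.2.2⟩

theorem IsTriple.card {Δ : SimpComplex V} {a b c : V} (h : IsTriple Δ a b c) :
    #({a, b, c} : Finset V) = 3 := card_eq_three.2 ⟨a, b, c, h.1, h.2.1, h.2.2.1, rfl⟩

theorem Matroidal.augment_pair {Δ : SimpComplex V} (hΔ : Matroidal Δ) {x y a b c : V}
    (hxy : (graph Δ).Adj x y) (h : IsTriple Δ a b c) :
    IsTriple Δ x y a ∨ IsTriple Δ x y b ∨ IsTriple Δ x y c := by
  obtain ⟨z, hz, hzxy, hmem⟩ := hΔ.augment {x, y} hxy.2 {a, b, c} h.2.2.2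
    (by rw [card_pair hxy.1, h.card]; omega)
  simp only [mem_insert, mem_singleton, not_or] at hz hzxy
  have : IsTriple Δ z x y := ⟨hzxy.1, hzxy.2, hxy.1, hmem⟩
  have := this.swap_left.swap_right
  rcases hz with rfl | rfl | rfl
  · exact Or.inl this
  · exact Or.inr (Or.inl this)
  · exact Or.inr (Or.inr this)

/-- Augment {b, c} from a basis that avoids a. -/
theorem Matroidal.exists_exchange {Δ : SimpComplex V} (hΔ : Matroidal Δ)
    (havoid : ∀ x, ∃ B ∈ Δ, #B = 3 ∧ x ∉ B) {a b c : V} (h : IsTriple Δ a b c) :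
    ∃ x, x ≠ a ∧ IsTriple Δ x b c := by
  obtain ⟨B, hB, hc, haB⟩ := havoid a
  obtain ⟨x, y, z, hxy, hxz, hyz, rfl⟩ := card_eq_three.1 hc
  simp only [mem_insert, mem_singleton, not_or] at haB
  rcases hΔ.augment_pair h.swap_left.swap_right.adj ⟨hxy, hxz, hyz, hB⟩ with h | h | h
  · exact ⟨x, Ne.symm haB.1, h.swap_right.swap_left⟩
  · exact ⟨y, Ne.symm haB.2.1, h.swap_right.swap_left⟩
  · exact ⟨z, Ne.symm haB.2.2, h.swap_right.swap_left⟩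

/-- The search is for a restriction isomorphic to U_{3,4}, U_{2,3} ⊕ U_{1,2} or a sum of three
copies of U_{1,2}; their independence complexes are the tetrahedron boundary, the bipyramid and the
octahedron. Each also has a basis avoiding any given element, as the later insertions need. -/
theorem Matroidal.exists_sphere {Δ : SimpComplex V} (hΔ : Matroidal Δ)
    (hrank : ∀ F ∈ Δ, #F ≤ 3) (havoid : ∀ x, ∃ B ∈ Δ, #B = 3 ∧ x ∉ B) [Nonempty V] :
    ∃ X, EarLike (Δ ⊓ simplex X) X ∧ ∀ x, ∃ B ∈ Δ, #B = 3 ∧ B ⊆ X ∧ x ∉ B := by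
  by_cases hU : ∃ a b c x, IsTriple Δ a b c ∧ IsTriple Δ x b c ∧ IsTriple Δ a x c ∧ IsTriple Δ a b x
  · obtain ⟨a, b, c, x, h1, h2, h3, h4⟩ := hU
    have hcard : #({x, a, b, c} : Finset V) = 4 := by
      rw [card_insert_of_notMem, h1.card]
      simp [h2.1, h2.2.1, h3.1.symm]
    have hx : ({x, a, b, c} : Finset V).erase x = {a, b, c} := by
      rw [erase_insert]; simp [h2.1, h2.2.1, h3.1.symm]
    have ha : ({x, a, b, c} : Finset V).erase a = {x, b, c} := by
      rw [Finset.insert_comm, erase_insert]; simp [h1.1, h1.2.1, h3.1]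
    have hb : ({x, a, b, c} : Finset V).erase b = {a, x, c} := by
      ext t
      have := h1.1; have := h2.1; have := h1.2.2.1
      simp only [mem_erase, mem_insert, mem_singleton]
      grind
    have hc : ({x, a, b, c} : Finset V).erase c = {a, b, x} := by
      ext t
      have := h1.2.1; have := h2.2.1; have := h1.2.2.1
      simp only [mem_erase, mem_insert, mem_singleton]
      grind
    have hfacet : ∀ t ∈ ({x, a, b, c} : Finset V), ({x, a, b, c} : Finset V).erase t ∈ Δ := by
      intro t ht
      simp only [mem_insert, mem_singleton] at ht
      rcases ht with rfl | rfl | rfl | rfl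
      · rw [hx]; exact h1.2.2.2
      · rw [ha]; exact h2.2.2.2
      · rw [hb]; exact h3.2.2.2
      · rw [hc]; exact h4.2.2.2
    refine ⟨{x, a, b, c}, ?_, fun t => ?_⟩
    · rw [inf_simplex_eq_tetrahedron (fun h => by have := hrank _ h; omega) hfacet]
      exact earLike_tetrahedron hcard
    · by_cases ht : t ∈ ({x, a, b, c} : Finset V)
      · exact ⟨_, hfacet t ht, by rw [card_erase_of_mem ht, hcard], erase_subset _ _,
          notMem_erase _ _⟩
      · exact ⟨_, hfacet x (by simp), by rw [hx, h1.card], erase_subset _ _,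
          fun h => ht (mem_of_mem_erase h)⟩
  push Not at hU
  have key2 (A B : Finset V) (hA : #A = 3) (hB : #B = 2) (hAB : Disjoint A B) (hA' : A ∉ Δ)
      (hB' : B ∉ Δ) (hfacet : ∀ a ∈ A, ∀ b ∈ B, A.erase a ∪ B.erase b ∈ Δ) :
      ∃ X, EarLike (Δ ⊓ simplex X) X ∧ ∀ x, ∃ B ∈ Δ, #B = 3 ∧ B ⊆ X ∧ x ∉ B := by
    refine ⟨A ∪ B, ?_, fun t => ?_⟩
    · rw [inf_simplex_eq_join hA' hB' hfacet]
      exact earLike_bipyramid hA hB hAB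
    · obtain ⟨a, ha, hta⟩ : ∃ a ∈ A, t ∉ A.erase a := by
        by_cases ht : t ∈ A
        · exact ⟨t, ht, notMem_erase _ _⟩
        · obtain ⟨a, ha⟩ := card_pos.1 (by omega : 0 < #A)
          exact ⟨a, ha, fun h => ht (mem_of_mem_erase h)⟩
      obtain ⟨b, hb, htb⟩ : ∃ b ∈ B, t ∉ B.erase b := by
        by_cases ht : t ∈ B
        · exact ⟨t, ht, notMem_erase _ _⟩
        · obtain ⟨b, hb⟩ := card_pos.1 (by omega : 0 < #B)
          exact ⟨b, hb, fun h => ht (mem_of_mem_erase h)⟩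
      refine ⟨_, hfacet a ha b hb, ?_, union_subset_union (erase_subset _ _) (erase_subset _ _),
        by simp [hta, htb]⟩
      rw [card_union_of_disjoint (hAB.mono (erase_subset _ _) (erase_subset _ _)),
        card_erase_of_mem ha, card_erase_of_mem hb]
      omega
  -- Now exactly three of the four triples in {a, b, c, x} are bases. The missing {a, b, x} is the
  -- three-element circuit, and c together with a replacement y of it will be the parallel pair.
  by_cases hL : ∃ a b c x, IsTriple Δ a b c ∧ IsTriple Δ x b c ∧ IsTriple Δ a x c
  · obtain ⟨a, b, c, x, habc, hxbc, haxc⟩ := hL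
    have habx : ¬ IsTriple Δ a b x := hU a b c x habc hxbc haxc
    obtain ⟨y, hyc, hyab⟩ := hΔ.exists_exchange havoid habc.swap_right.swap_left
    have haby : IsTriple Δ a b y := hyab.swap_left.swap_right
    have haxy : IsTriple Δ a x y := by
      rcases hΔ.augment_pair haxc.adj haby with h | h | h
      · exact absurd rfl h.2.1
      · exact absurd h.swap_right habx
      · exact h
    have hbxy : IsTriple Δ b x y := by
      rcases hΔ.augment_pair hxbc.swap_left.adj haby with h | h | h
      · exact absurd h.swap_right.swap_left habx
      · exact absurd rfl h.2.1
      · exact h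
    -- If {a, c, y} were a basis, {b, c, y} could not be one, as a, b, c, y would form a U_{3,4}.
    -- Augmenting {c, y} from {x, b, c} then makes {x, c, y} a basis, and a, x, c, y form a U_{3,4}.
    have half : ∀ a b, IsTriple Δ a b c → IsTriple Δ x b c → IsTriple Δ a x c → IsTriple Δ a b y →
        IsTriple Δ a x y → (graph Δ).Adj c y → ¬ IsTriple Δ a c y := by
      intro a b habc hxbc haxc haby haxy hcy hacy
      have hbcy : ¬ IsTriple Δ b c y := fun h =>
        hU a b c y habc h.swap_right.swap_left
          hacy.swap_right haby
      have hxcy : IsTriple Δ x c y := by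
        rcases hΔ.augment_pair hcy hxbc with h | h | h
        · exact h.swap_right.swap_left
        · exact absurd h.swap_right.swap_left hbcy
        · exact absurd rfl h.2.1
      exact hU a x c y haxc hxcy.swap_right.swap_left
        hacy.swap_right haxy
    have hcy : ¬ (graph Δ).Adj c y := by
      intro hcy
      rcases hΔ.augment_pair hcy habc with h | h | h
      · exact half a b habc hxbc haxc haby haxy hcy h.swap_right.swap_left
      · exact half b a habc.swap_left haxc.swap_left hxbc.swap_left haby.swap_left hbxy hcy
          h.swap_right.swap_left
      · exact absurd rfl h.2.1
    have hab := habc.1; have hac := habc.2.1; have hbc := habc.2.2.1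
    have hxb := hxbc.1; have hxc := hxbc.2.1; have hax := haxc.1
    have hay := haby.2.1; have hby := haby.2.2.1; have hxy := haxy.2.2.1
    refine key2 {a, b, x} {c, y} (card_eq_three.2 ⟨a, b, x, hab, hax, hxb.symm, rfl⟩)
      (card_pair hyc.symm) ?_ (fun h => habx ⟨hab, hax, hxb.symm, h⟩) (fun h => hcy ⟨hyc.symm, h⟩) ?_
    · simp [hac.symm, hbc.symm, hxc.symm, hay.symm, hby.symm, hxy.symm]
    · have ea : ({a, b, x} : Finset V).erase a = {b, x} := by
        rw [erase_insert]; simp [hab, hax]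
      have eb : ({a, b, x} : Finset V).erase b = {a, x} := by
        rw [Finset.insert_comm, erase_insert]; simp [hab.symm, hxb.symm]
      have ex : ({a, b, x} : Finset V).erase x = {a, b} := by
        ext t
        simp only [mem_erase, mem_insert, mem_singleton]
        grind
      have ec : ({c, y} : Finset V).erase c = {y} := by
        rw [erase_insert]; simp [hyc.symm]
      have ey : ({c, y} : Finset V).erase y = {c} := by
        rw [pair_comm, erase_insert]; simp [hyc]
      intro s hs t ht
      simp only [mem_insert, mem_singleton] at hs ht
      rcases hs with rfl | rfl | rfl <;> rcases ht with rfl | rfl <;>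
        simp only [ea, eb, ex, ec, ey, insert_union, singleton_union]
      · exact hbxy.2.2.2
      · exact hxbc.swap_left.2.2.2
      · exact haxy.2.2.2
      · exact haxc.2.2.2
      · exact haby.2.2.2
      · exact habc.2.2.2
  push Not at hL
  obtain ⟨a, b, c, habc⟩ : ∃ a b c, IsTriple Δ a b c := by
    obtain ⟨B, hB, hc, -⟩ := havoid (Classical.arbitrary V)
    obtain ⟨x, y, z, hxy, hxz, hyz, rfl⟩ := card_eq_three.1 hc
    exact ⟨x, y, z, hxy, hxz, hyz, hB⟩
  -- With both earlier configurations excluded, an element and any replacement of it in a basis are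
  -- parallel. Replacing all three elements of one basis yields three parallel pairs, hence an
  -- octahedron.
  have hpair : ∀ a b c x, IsTriple Δ a b c → IsTriple Δ x b c → ¬ (graph Δ).Adj a x := by
    intro a b c x habc hxbc hax
    rcases hΔ.augment_pair hax habc with h | h | h
    · exact h.2.1 rfl
    · exact hL a c b x habc.swap_right hxbc.swap_right h
    · exact hL a b c x habc hxbc h
  obtain ⟨a', ha, h1⟩ := hΔ.exists_exchange havoid habc
  obtain ⟨b', hb, h2'⟩ := hΔ.exists_exchange havoid habc.swap_left
  obtain ⟨c', hc, h3'⟩ := hΔ.exists_exchange havoid habc.swap_right.swap_left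
  have h2 := h2'.swap_left
  have h3 := h3'.swap_left.swap_right
  have na : ¬ (graph Δ).Adj a a' := hpair a b c a' habc h1
  have nb : ¬ (graph Δ).Adj b b' := hpair b a c b' habc.swap_left h2'
  have nc : ¬ (graph Δ).Adj c c' := hpair c a b c' habc.swap_right.swap_left h3'
  have h12 : IsTriple Δ a' b' c := by
    rcases hΔ.augment_pair h1.swap_right.adj h2 with h | h | h
    · exact absurd h.swap_right.adj.symm na
    · exact h.swap_right
    · exact absurd rfl h.2.2.1
  have h13 : IsTriple Δ a' b c' := by
    rcases hΔ.augment_pair h1.adj h3 with h | h | h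
    · exact absurd h.swap_right.adj.symm na
    · exact absurd rfl h.2.2.1
    · exact h
  have h23 : IsTriple Δ a b' c' := by
    rcases hΔ.augment_pair h2.adj h3 with h | h | h
    · exact absurd rfl h.2.1
    · exact absurd h.swap_left.swap_right.adj.symm nb
    · exact h
  have h123 : IsTriple Δ a' b' c' := by
    rcases hΔ.augment_pair h12.adj h3 with h | h | h
    · exact absurd h.swap_right.adj.symm na
    · exact absurd h.swap_left.swap_right.adj.symm nb
    · exact h
  have hAB : Disjoint ({a, a'} : Finset V) {b, b'} := by
    simp [habc.1.symm, h1.1.symm, h2.1.symm, h12.1.symm]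
  have hAC : Disjoint ({a, a'} : Finset V) {c, c'} := by
    simp [habc.2.1.symm, h1.2.1.symm, h3.2.1.symm, h13.2.1.symm]
  have hBC : Disjoint ({b, b'} : Finset V) {c, c'} := by
    simp [habc.2.2.1.symm, h2.2.2.1.symm, h3.2.2.1.symm, h23.2.2.1.symm]
  have erase_left : ∀ x y : V, y ≠ x → ({x, y} : Finset V).erase x = {y} := fun x y h => by
    rw [erase_insert]; simpa using h.symm
  have erase_right : ∀ x y : V, y ≠ x → ({x, y} : Finset V).erase y = {x} := fun x y h => by
    rw [pair_comm, erase_left y x h.symm]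
  have hfacet : ∀ s ∈ ({a, a'} : Finset V), ∀ t ∈ ({b, b'} : Finset V), ∀ u ∈ ({c, c'} : Finset V),
      ∃ x y z, ({a, a'} : Finset V).erase s ∪ (({b, b'} : Finset V).erase t ∪
        ({c, c'} : Finset V).erase u) = {x, y, z} ∧ IsTriple Δ x y z := by
    intro s hs t ht u hu
    simp only [mem_insert, mem_singleton] at hs ht hu
    rcases hs with rfl | rfl <;> rcases ht with rfl | rfl <;> rcases hu with rfl | rfl <;>
      simp only [erase_left _ _ ha, erase_left _ _ hb, erase_left _ _ hc, erase_right _ _ ha,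
        erase_right _ _ hb, erase_right _ _ hc, singleton_union]
    · exact ⟨_, _, _, rfl, h123⟩
    · exact ⟨_, _, _, rfl, h12⟩
    · exact ⟨_, _, _, rfl, h13⟩
    · exact ⟨_, _, _, rfl, h1⟩
    · exact ⟨_, _, _, rfl, h23⟩
    · exact ⟨_, _, _, rfl, h2⟩
    · exact ⟨_, _, _, rfl, h3⟩
    · exact ⟨_, _, _, rfl, habc⟩
  refine ⟨{a, a'} ∪ ({b, b'} ∪ {c, c'}), ?_, fun x => ?_⟩
  · rw [inf_simplex_eq_join_join (fun h => na ⟨ha.symm, h⟩) (fun h => nb ⟨hb.symm, h⟩)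
      (fun h => nc ⟨hc.symm, h⟩)]
    · exact earLike_octahedron (card_pair ha.symm) (card_pair hb.symm) (card_pair hc.symm) hAB hAC
        hBC
    · intro s hs t ht u hu
      obtain ⟨x, y, z, h, h'⟩ := hfacet s hs t ht u hu
      rw [h]
      exact h'.2.2.2
  · have hpick : ∀ p q : V, ∃ s ∈ ({p, q} : Finset V), x ∉ ({p, q} : Finset V).erase s := by
      intro p q
      by_cases hx : x ∈ ({p, q} : Finset V)
      · exact ⟨x, hx, notMem_erase _ _⟩
      · exact ⟨p, by simp, fun h => hx (mem_of_mem_erase h)⟩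
    obtain ⟨s, hs, hxs⟩ := hpick a a'
    obtain ⟨t, ht, hxt⟩ := hpick b b'
    obtain ⟨u, hu, hxu⟩ := hpick c c'
    obtain ⟨y, z, w, h, h'⟩ := hfacet s hs t ht u hu
    refine ⟨({a, a'} : Finset V).erase s ∪ (({b, b'} : Finset V).erase t ∪
        ({c, c'} : Finset V).erase u), ?_, ?_, ?_, ?_⟩
    · rw [h]; exact h'.2.2.2
    · rw [h]; exact h'.card
    · exact union_subset_union (erase_subset _ _)
        (union_subset_union (erase_subset _ _) (erase_subset _ _))
    · simp only [mem_union, not_or]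
      exact ⟨hxs, hxt, hxu⟩

/-- Start from the sphere and insert the remaining elements in any order; bases inside the sphere
keep every intermediate restriction free of coloops. -/
theorem Matroidal.earLike {Δ : SimpComplex V} (hΔ : Matroidal Δ) {E : Finset V}
    (hE : ∀ F ∈ Δ, F ⊆ E) (hrank : ∀ F ∈ Δ, #F ≤ 3)
    (havoid : ∀ x, ∃ B ∈ Δ, #B = 3 ∧ x ∉ B) [Nonempty V] : ∃ W, EarLike Δ W := by
  obtain ⟨X, hX, hX'⟩ := hΔ.exists_sphere hrank havoid
  have : ∀ R : Finset V, ∃ W, EarLike (Δ ⊓ simplex (R ∪ X)) W := by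
    intro R
    induction R using Finset.induction_on with
    | empty => exact ⟨X, by simpa using hX⟩
    | insert e R _ ih =>
      obtain ⟨W, hW⟩ := ih
      rw [insert_union]
      by_cases he : e ∈ R ∪ X
      · exact ⟨W, by rwa [insert_eq_of_mem he]⟩
      · refine hΔ.earLike_insert he (fun x => ?_) hW
        obtain ⟨B, h1, h2, h3, h4⟩ := hX' x
        exact ⟨B, h1, h2, h3.trans subset_union_right, h4⟩
  obtain ⟨W, hW⟩ := this E
  refine ⟨W, ?_⟩
  convert hW using 1
  ext F
  exact ⟨fun h => ⟨h, (hE F h).trans subset_union_left⟩, fun h => h.1⟩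

end Matroidal

section Coloops

open Classical

variable {V : Type*}

/-! ### Independence complexes of matroids of rank three -/

theorem mem_indepComplex {M : Matroid V} {F : Finset V} :
    F ∈ indepComplex M ↔ M.Indep (F : Set V) := Iff.rfl

theorem matroidal_indepComplex (M : Matroid V) : Matroidal (indepComplex M) := by
  refine ⟨by simp [mem_indepComplex], fun I hI J hJ hIJ => ?_⟩
  obtain ⟨x, hxJ, hxI, h⟩ := Matroid.Indep.augment_finset hI hJ hIJ
  exact ⟨x, hxJ, hxI, by rw [mem_indepComplex, coe_insert]; exact h⟩

/-- The faces of `Δ` disjoint from `K`. -/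
def deletion (Δ : SimpComplex V) (K : Finset V) : SimpComplex V where
  carrier := {F | F ∈ Δ ∧ Disjoint F K}
  lower' := fun _ _ h hF => ⟨Δ.lower h hF.1, hF.2.mono_left h⟩

theorem Matroidal.deletion {Δ : SimpComplex V} (hΔ : Matroidal Δ) (K : Finset V) :
    Matroidal (deletion Δ K) := by
  refine ⟨⟨hΔ.empty_mem, disjoint_empty_left K⟩, fun I hI J hJ hIJ => ?_⟩
  obtain ⟨x, hxJ, hxI, h⟩ := hΔ.augment I hI.1 J hJ.1 hIJ
  exact ⟨x, hxJ, hxI, h, disjoint_insert_left.2 ⟨disjoint_left.1 hJ.2 hxJ, hI.2⟩⟩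

theorem deletion_empty (Δ : SimpComplex V) : deletion Δ ∅ = Δ := by
  ext F
  exact ⟨fun h => h.1, fun h => ⟨h, disjoint_empty_right F⟩⟩

theorem numFaces_eq_zero {Δ : SimpComplex V} {i : ℕ} (h : ∀ F ∈ Δ, #F ≠ i) : numFaces Δ i = 0 := by
  rw [numFaces]
  convert Set.ncard_empty (Finset V)
  ext F
  simp only [Set.mem_ofPred_eq, Set.mem_empty_iff_false, iff_false, not_and]
  exact h F

/-- The complex is the join of the simplex on the coloops with the deletion, which is matroidal of
rank 3 - c without coloops. Expanding the join shows that the entries beyond 3 - c vanish. -/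
theorem indepComplex_hVector (M : Matroid V) [M.Finite] (hM : M.eRank = 3) (c : ℕ)
    (hc : M.coloops.ncard = c) :
    (∀ j : ℕ, 3 - c < j → j ≤ 3 → hEntry 3 (indepComplex M) j = 0) ∧
      IsPureOSequence (fun j : Fin (3 - c + 1) => hEntry 3 (indepComplex M) j) := by
  set Δ := indepComplex M with hΔ
  have hMat : Matroidal Δ := matroidal_indepComplex M
  obtain ⟨E, hEE⟩ := (M.set_finite M.E le_rfl).exists_finset_coe
  obtain ⟨K, hK⟩ := (M.set_finite M.coloops M.coloops_subset_ground).exists_finset_coe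
  have hKc : #K = c := by rw [← hc, ← hK, Set.ncard_coe_finset]
  have hE : ∀ F ∈ Δ, F ⊆ E := fun F hF => by
    have := Matroid.Indep.subset_ground hF
    rwa [← hEE, coe_subset] at this
  have hrank : ∀ F ∈ Δ, #F ≤ 3 := fun F hF => by
    have := Matroid.Indep.encard_le_eRank hF
    rw [hM, Set.encard_coe_eq_coe_finsetCard] at this
    exact_mod_cast this
  have hbase : ∀ B, M.IsBase B → ∃ B' ∈ Δ, #B' = 3 ∧ (B' : Set V) = B := by
    intro B hB
    obtain ⟨B', rfl⟩ := (M.set_finite B hB.subset_ground).exists_finset_coe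
    refine ⟨B', hB.indep, ?_, rfl⟩
    have := hB.encard_eq_eRank
    rw [hM, Set.encard_coe_eq_coe_finsetCard] at this
    exact_mod_cast this
  have hunion : ∀ F, F ∪ K ∈ Δ ↔ F ∈ Δ := fun F => by
    rw [hΔ, mem_indepComplex, mem_indepComplex, coe_union,
      Matroid.union_indep_iff_indep_of_subset_coloops hK.subset]
  have hK3 : c ≤ 3 := by
    have : ∅ ∪ K ∈ Δ := (hunion ∅).2 hMat.empty_mem
    rw [empty_union] at this
    rw [← hKc]
    exact hrank K this
  -- A noncoloop is missed by some basis, while a coloop is removed along with K; either way the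
  -- basis minus K avoids x and has 3 - c elements.
  have havoid : ∀ x, ∃ B ∈ deletion Δ K, #B = 3 - c ∧ x ∉ B := by
    intro x
    obtain ⟨B, hB, hxB⟩ : ∃ B, M.IsBase B ∧ (x ∈ B → x ∈ K) := by
      by_cases hx : x ∈ K
      · obtain ⟨B, hB⟩ := M.exists_isBase
        exact ⟨B, hB, fun _ => hx⟩
      · have hx' : ¬ M.IsColoop x := by
          rwa [Matroid.isColoop_iff_mem_coloops, ← hK, mem_coe]
        rw [Matroid.isColoop_iff_forall_mem_isBase] at hx'
        push Not at hx'
        obtain ⟨B, hB, hxB⟩ := hx'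
        exact ⟨B, hB, fun h => absurd h hxB⟩
    obtain ⟨B', hB', hBc, rfl⟩ := hbase B hB
    have hKB : K ⊆ B' := by
      rw [← coe_subset, hK]
      exact hB.coloops_subset
    refine ⟨B' \ K, ⟨Δ.lower sdiff_subset hB', sdiff_disjoint⟩, ?_, ?_⟩
    · rw [card_sdiff_of_subset hKB, hBc, hKc]
    · rw [mem_sdiff]
      exact fun h => h.2 (hxB h.1)
  have : Nonempty V := by
    obtain ⟨B, hB⟩ := M.exists_isBase
    obtain ⟨B', -, hBc, -⟩ := hbase B hB
    obtain ⟨x, -⟩ := card_pos.1 (by omega : 0 < #B')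
    exact ⟨x⟩
  have hΓ := hMat.deletion K
  have hΓE : ∀ F ∈ deletion Δ K, F ⊆ E \ K := fun F hF => subset_sdiff.2 ⟨hE F hF.1, hF.2⟩
  have hΓrank : ∀ F ∈ deletion Δ K, #F + c ≤ 3 := fun F hF => by
    have := hrank _ ((hunion F).2 hF.1)
    rwa [card_union_of_disjoint hF.2, hKc] at this
  have hjoin : Δ = join (simplex K) (deletion Δ K) := by
    ext F
    constructor
    · intro hF
      exact ⟨F ∩ K, inter_subset_right, F \ K, ⟨Δ.lower sdiff_subset hF, sdiff_disjoint⟩,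
        by rw [union_comm, sdiff_union_inter]⟩
    · rintro ⟨G, hG, H, hH, rfl⟩
      refine Δ.lower ?_ ((hunion H).2 hH.1)
      rw [union_comm]
      exact union_subset_union le_rfl hG
  have hnum : ∀ i, numFaces Δ i =
      ∑ p ∈ antidiagonal i, c.choose p.1 * numFaces (deletion Δ K) p.2 := fun i => by
    rw [hjoin, numFaces_join (fun F hF => hF) hΓE disjoint_sdiff, ← hjoin]
    simp only [numFaces_simplex, hKc]
  have γ0 := numFaces_zero hΓ.empty_mem
  have γ (i : ℕ) (hi : 3 - c < i) : numFaces (deletion Δ K) i = 0 :=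
    numFaces_eq_zero fun F hF => by have := hΓrank F hF; omega
  obtain ⟨h0, h1, h2, h3⟩ := hEntry_three Δ (numFaces_zero hMat.empty_mem)
  have n1 : numFaces Δ 1 = numFaces (deletion Δ K) 1 + c := by
    rw [hnum]
    simp [Nat.antidiagonal_succ, γ0]
  have n2 : numFaces Δ 2 =
      numFaces (deletion Δ K) 2 + c * numFaces (deletion Δ K) 1 + c.choose 2 := by
    rw [hnum]
    simp [Nat.antidiagonal_succ, γ0]
    ring
  have n3 : numFaces Δ 3 = numFaces (deletion Δ K) 3 + c * numFaces (deletion Δ K) 2 +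
      c.choose 2 * numFaces (deletion Δ K) 1 + c.choose 3 := by
    rw [hnum]
    simp [Nat.antidiagonal_succ, γ0]
    ring
  rcases (by omega : c = 0 ∨ c = 1 ∨ c = 2 ∨ c = 3) with rfl | rfl | rfl | rfl
  · refine ⟨fun j h1 h2 => by omega, ?_⟩
    rw [card_eq_zero.1 hKc, deletion_empty] at havoid
    obtain ⟨W, hW⟩ := hMat.earLike hE hrank havoid
    exact hW.isPureOSequence
  · obtain ⟨b1, b2, b3, b4⟩ := hΓ.rank_two_bounds hΓE havoid
    rw [γ 3 (by omega)] at n3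
    set u := numFaces (deletion Δ K) 1
    set w := numFaces (deletion Δ K) 2
    simp [Nat.choose] at n2 n3
    refine ⟨fun j hj hj' => ?_, ?_⟩
    · obtain rfl : j = 3 := by omega
      rw [h3]; omega
    · obtain ⟨n, hn⟩ : ∃ n, u = n + 2 := ⟨u - 2, by omega⟩
      rw [hn, choose_two_succ] at b4
      -- One coloop gives (1, u - 2, w - u + 1), and the requirements become u ≥ 3, u ≤ w, 2u ≤ w +
      -- 4 and w ≤ C(u,2).
      refine isPureOSequence_two (n := n) _ (w + 1 - u) (by omega) (by omega) (by omega) (by omega)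
        h0 (h1.trans ?_) (h2.trans ?_)
      · omega
      · omega
  · have b1 : 2 ≤ numFaces (deletion Δ K) 1 := by
      obtain ⟨B, hB, hBc, -⟩ := havoid (Classical.arbitrary V)
      obtain ⟨x, rfl⟩ := card_eq_one.1 hBc
      obtain ⟨B', hB', hBc', hx⟩ := havoid x
      obtain ⟨y, rfl⟩ := card_eq_one.1 hBc'
      rw [numFaces_eq_card_filter hΓE]
      refine one_lt_card.2 ⟨{x}, ?_, {y}, ?_, fun h => hx (h ▸ mem_singleton_self x)⟩
      · exact mem_filter.2 ⟨mem_powersetCard.2 ⟨hΓE _ hB, hBc⟩, hB⟩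
      · exact mem_filter.2 ⟨mem_powersetCard.2 ⟨hΓE _ hB', hBc'⟩, hB'⟩
    rw [γ 2 (by omega)] at n2 n3
    rw [γ 3 (by omega)] at n3
    simp [Nat.choose] at n2 n3
    refine ⟨fun j hj hj' => ?_, ?_⟩
    · rcases (by omega : j = 2 ∨ j = 3) with rfl | rfl
      · rw [h2]; omega
      · rw [h3]; omega
    · obtain ⟨n, hn⟩ : ∃ n, numFaces (deletion Δ K) 1 = n + 1 :=
        ⟨numFaces (deletion Δ K) 1 - 1, by omega⟩
      refine isPureOSequence_one (n := n) _ (by omega) h0 (h1.trans ?_)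
      omega
  · rw [γ 1 (by omega)] at n1 n2 n3
    rw [γ 2 (by omega)] at n2 n3
    rw [γ 3 (by omega)] at n3
    simp [Nat.choose] at n1 n2 n3
    refine ⟨fun j hj hj' => ?_, isPureOSequence_zero _ h0⟩
    rcases (by omega : j = 1 ∨ j = 2 ∨ j = 3) with rfl | rfl | rfl
    · rw [h1]; omega
    · rw [h2]; omega
    · rw [h3]; omega

end Coloops

end PSEar

theorem theorem1p5 {V : Type*} :
    (∀ Δ : PSEar.SimpComplex V, PSEar.IsPSEarDecomposable Δ 2 →
      PSEar.IsPureOSequence (fun j : Fin (3 + 1) => PSEar.hEntry 3 Δ j)) ∧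
    (∀ (M : Matroid V) [M.Finite], M.eRank = 3 →
      (∀ j : ℕ, 3 - M.coloops.ncard < j → j ≤ 3 →
        PSEar.hEntry 3 (PSEar.indepComplex M) j = 0) ∧
      PSEar.IsPureOSequence (fun j : Fin (3 - M.coloops.ncard + 1) =>
        PSEar.hEntry 3 (PSEar.indepComplex M) j)) := by
  refine ⟨fun Δ hΔ => ?_, fun M _ hM => PSEar.indepComplex_hVector M hM _ rfl⟩
  obtain ⟨W, hW⟩ := hΔ.earLike
  exact hW.isPureOSequence
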